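/- For every integer $N \ge 1$ consider a network of $N$ lines whose surplus capacities $C^N(1),\dots,C^N(N)$ are i.i.d. real random variables with common distribution function $F$ (not depending on $N$), and let $C^N_{(1)} \le \dots \le C^N_{(N)}$ be their order statistics. Let $l^N(1),\dots,l^N(N)$ be real numbers (the load surges), and let the number of failed lines be $$A^N = \max\{m \in \{0,\dots,N\} : C^N_{(i)} \le l^N(i) \text{ for all } i=1,\dots,m\}.$$ Suppose that, for a constant $\theta>0$ and a function $\Delta(\cdot,\cdot)$, $$F(l^N(i)) = \frac{\theta+i-1+\Delta(i,N)}{N}, \qquad 1 \le i \le N .$$ Let $k=k(N)\le N$ be nonnegative integers with $k\to\infty$ and $N-k\to\infty$ as $N\to\infty$. Assume: (A) $\Delta(i,N)\in[-(\theta+i-1),\,N-(\theta+i-1)]$ for all $1\le i\le N$; (B) $\Delta(i+1,N)\ge\Delta(i,N)-1$ for all $1\le i<i+1\le N$; (C) for every $i\ge 1$, $\Delta(i,N)\to\Delta(i)$ as $N\to\infty$, where $\Delta(\cdot)$ is a real function with $\lim_{i\to\infty}\Delta(i)=0$; (D) for all $i(N)\le k(N)$ with $\lim_{N\to\infty} i(N)=\infty$,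 one has $\lim_{N\to\infty}\Delta(i(N),N)=0$. Put $c_i=\theta+i-1+\Delta(i)$ for $i\ge 1$, and assume $c_1>0$. Let $\beta_0=1$ and $\beta_i=\sum_{j=1}^{i}\frac{(-1)^{j+1}}{j!}\beta_{i-j}(c_{i-j+1})^j$ for $i\ge1$, let $\gamma(s,x)=\int_0^x t^{s-1}e^{-t}\,dt$, and for $M\ge 1$ let $$V_M(\theta,\Delta)=\frac{2}{\sqrt{2\pi}}\Bigl(\frac{\theta}{(M-1)!}\gamma(M,c_M)+\frac{(c_M)^M}{(M-1)!}e^{-c_M}+\sum_{j=1}^{M-1}\beta_{j-1}e^{-c_j}\frac{\Delta(j)}{(M-j)!}\gamma(M-j+1,c_M-c_j)-\sum_{j=1}^{M-1}\beta_{j-1}\frac{(c_M-c_j)^{M-j+1}}{(M-j)!}e^{-c_M}\Bigr).$$ Then the limit $V(\theta,\Delta)=\lim_{M\to\infty}V_M(\theta,\Delta)$ exists and lies in $(0,\infty)$, and $$\lim_{N\to\infty}\sqrt{\frac{kN}{N-k}}\;\mathbb{P}(A^N\ge k)=V(\theta,\Delta).$$ -/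

import Mathlib

open Filter Topology MeasureTheory ProbabilityTheory

noncomputable section

namespace Cascade

/-- The order statistics `x_(1) ≤ … ≤ x_(N)` of a vector `x` (numbered from `0` by `Fin N`). -/
def orderStat {N : ℕ} (x : Fin N → ℝ) : Fin N → ℝ := x ∘ Tuple.sort x

/-- The number of failed lines in a network of `N` lines with surplus capacities `x` and load
surge function `l`: the largest `m ≤ N` with `x_(i) ≤ l i` for `i = 1, …, m`
(it is `0` if `x_(1) > l 1`). -/
def blackoutSize {N : ℕ} (l : ℕ → ℝ) (x : Fin N → ℝ) : ℕ :=
  sSup {m : ℕ | m ≤ N ∧ ∀ i : Fin N, (i : ℕ) + 1 ≤ m → orderStat x i ≤ l ((i : ℕ) + 1)}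

/-- The supremum in the definition of `blackoutSize` is attained. -/
theorem blackoutSize_isGreatest {N : ℕ} (l : ℕ → ℝ) (x : Fin N → ℝ) :
    IsGreatest {m : ℕ | m ≤ N ∧ ∀ i : Fin N, (i : ℕ) + 1 ≤ m → orderStat x i ≤ l ((i : ℕ) + 1)}
      (blackoutSize l x) := by
  have hb : BddAbove
      {m : ℕ | m ≤ N ∧ ∀ i : Fin N, (i : ℕ) + 1 ≤ m → orderStat x i ≤ l ((i : ℕ) + 1)} :=
    ⟨N, fun m hm => hm.1⟩
  exact ⟨Nat.sSup_mem ⟨0, Nat.zero_le N, fun i hi => by omega⟩ hb, fun m hm => le_csSup hb hm⟩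

/-- `C 0, …, C (N - 1)` are independent random variables with common distribution
function `F`. -/
structure IsSurplusSample {Ω : Type*} [MeasurableSpace Ω] {N : ℕ} (P : Measure Ω)
    (C : Fin N → Ω → ℝ) (F : ℝ → ℝ) : Prop where
  measurable : ∀ j, Measurable (C j)
  indep : iIndepFun C P
  distribution : ∀ j x, P.real {ω | C j ω ≤ x} = F x

/-- Condition (A): `Δ(i,N) ∈ [-(θ+i-1), N-(θ+i-1)]`, for the lines `1 ≤ i ≤ N`. -/
def CondA (θ : ℝ) (Δ : ℕ → ℕ → ℝ) : Prop :=
  ∀ N i : ℕ, 1 ≤ i → i ≤ N →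
    Δ i N ∈ Set.Icc (-(θ + (i : ℝ) - 1)) ((N : ℝ) - (θ + (i : ℝ) - 1))

/-- Condition (B): `Δ(i+1,N) ≥ Δ(i,N) - 1`, for the lines `1 ≤ i < i + 1 ≤ N`. -/
def CondB (Δ : ℕ → ℕ → ℝ) : Prop :=
  ∀ N i : ℕ, 1 ≤ i → i + 1 ≤ N → Δ i N - 1 ≤ Δ (i + 1) N

/-- Condition (C), with the limit function `D`: `Δ(i,N) → D(i)` as `N → ∞` for every `i ≥ 1`,
and `D(i) → 0` as `i → ∞`. -/
def CondC (Δ : ℕ → ℕ → ℝ) (D : ℕ → ℝ) : Prop :=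
  (∀ i : ℕ, 1 ≤ i → Tendsto (fun N => Δ i N) atTop (𝓝 (D i))) ∧ Tendsto D atTop (𝓝 0)

/-- Condition (D): `Δ(i(N),N) → 0` for all `i(N) ≤ k(N)` with `i(N) → ∞`. -/
def CondD (Δ : ℕ → ℕ → ℝ) (k : ℕ → ℕ) : Prop :=
  ∀ i : ℕ → ℕ, (∀ N, i N ≤ k N) → Tendsto i atTop atTop →
    Tendsto (fun N => Δ (i N) N) atTop (𝓝 0)

/-- The limiting sequence `c_i = θ + i - 1 + D(i)`. -/
def cSeq (θ : ℝ) (D : ℕ → ℝ) (i : ℕ) : ℝ := θ + (i : ℝ) - 1 + D i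

/-- `β_0 = 1` and `β_i = ∑_{j=1}^i (-1)^(j+1) / j! * β_{i-j} * (c_{i-j+1})^j` for `i ≥ 1`. In the
second clause `i + 1` stands for the index, and `j + 1` for the summation variable. -/
def betaSeq (c : ℕ → ℝ) : ℕ → ℝ
  | 0 => 1
  | i + 1 => ∑ j : Fin (i + 1),
      (-1 : ℝ) ^ ((j : ℕ) + 2) / (Nat.factorial ((j : ℕ) + 1) : ℝ) *
        betaSeq c (i - (j : ℕ)) * c (i - (j : ℕ) + 1) ^ ((j : ℕ) + 1)
  termination_by n => n
  decreasing_by omega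

/-- The lower incomplete gamma function `γ(s,x) = ∫_0^x t^(s-1) e^(-t) dt` at integers `s ≥ 1`. -/
def lowerGamma (s : ℕ) (x : ℝ) : ℝ := ∫ t in (0 : ℝ)..x, t ^ (s - 1) * Real.exp (-t)

/-- The constant `V_M` for the affine parameter `θ` and the limiting perturbations `D`
(meaningful for `M ≥ 1`). -/
def VM (θ : ℝ) (D : ℕ → ℝ) (M : ℕ) : ℝ :=
  2 / √(2 * Real.pi) *
    (θ / (Nat.factorial (M - 1) : ℝ) * lowerGamma M (cSeq θ D M)
      + cSeq θ D M ^ M / (Nat.factorial (M - 1) : ℝ) * Real.exp (-cSeq θ D M)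
      + ∑ j ∈ Finset.Icc 1 (M - 1),
          betaSeq (cSeq θ D) (j - 1) * Real.exp (-cSeq θ D j) *
            (D j / (Nat.factorial (M - j) : ℝ)) *
              lowerGamma (M - j + 1) (cSeq θ D M - cSeq θ D j)
      - ∑ j ∈ Finset.Icc 1 (M - 1),
          betaSeq (cSeq θ D) (j - 1) *
            ((cSeq θ D M - cSeq θ D j) ^ (M - j + 1) / (Nat.factorial (M - j) : ℝ)) *
              Real.exp (-cSeq θ D M))

end Cascade

end

/-! For `0 ≤ p 1 ≤ … ≤ p n ≤ 1`, the number `n! * betaSeq p n` is the probability that the order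
statistics of `n` uniform variables lie below `p 1, …, p n`. With `p i = F (l i)`, decompose by the
first level that fails: exactly `m` variables lie below level `m + 1`, they cover their own levels,
and the remaining ones lie above. Independence gives P(A = m) = N! β_m(p) (1 - p_{m+1})^(N-m) /
(N-m)! (`measureReal_coverEvent`).

The identity Σ_j β_j (x - c_{j+1})^(n-j) / (n-j)! = x^n / n! (`sum_betaSeq_mul_divPow`) at `x = 1`
turns P(A ≥ k) into the sum of these expressions over `k ≤ m ≤ N`. As P(A ≥ k) involves only the
first `k` levels, the perturbations beyond `k` may be replaced by `0` without changing the sum.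
After scaling by `N`, each term becomes β_m(c) / `abelCoeff m θ` times the mass of the unperturbed
affine case, `affineMass`.

The first factor tends to `ratioLimit`. Subtracting the identity above at orders `n` and `n - 1`
compares β with Abel coefficients (`betaSeq_cSeq_eq`), and dividing by `abelCoeff m θ` gives θ plus
a sum whose terms converge and whose tails are controlled by weights of order n^(-3/2)
(`tendsto_betaSeq_div_abelCoeff`). By Stirling, the second factor is asymptotically `2 / √(2π)`
times the increment of √(1/m - 1/N) (`exists_affineMass_ratio`). These increments telescope to √(1/k
- 1/N), the inverse of the normalising factor. Finally, V_M is `2 / √(2π)` times a partial sum of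
the series defining `ratioLimit` (`VM_succ`), and a second use of the Abel comparison gives
positivity (`ratioLimit_pos`). -/

namespace Cascade

open Finset

/-! ### Divided powers and the algebra of the sequence β -/

/-- The divided power `x ^ n / n!`. -/
noncomputable def divPow (n : ℕ) (x : ℝ) : ℝ := x ^ n / (n.factorial : ℝ)

@[simp] theorem divPow_zero_left (x : ℝ) : divPow 0 x = 1 := by simp [divPow]

theorem divPow_zero_right {n : ℕ} (hn : n ≠ 0) : divPow n 0 = 0 := by simp [divPow, hn]

theorem divPow_nonneg (n : ℕ) {x : ℝ} (hx : 0 ≤ x) : 0 ≤ divPow n x := by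
  unfold divPow; positivity

theorem divPow_add (n : ℕ) (x y : ℝ) :
    divPow n (x + y) = ∑ p ∈ antidiagonal n, divPow p.1 x * divPow p.2 y := by
  unfold divPow
  rw [(Commute.all x y).add_pow', Finset.sum_div]
  refine Finset.sum_congr rfl fun p hp => ?_
  have h : p.1 + p.2 = n := by simpa using hp
  have := Nat.choose_mul_factorial_mul_factorial (h ▸ Nat.le_add_right p.1 p.2 : p.1 ≤ n)
  rw [show n - p.1 = p.2 by omega] at this
  have h' : ((n.choose p.1 : ℕ) : ℝ) * (p.1.factorial : ℝ) * (p.2.factorial : ℝ)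
      = (n.factorial : ℝ) := by exact_mod_cast this
  have h1 : (p.1.factorial : ℝ) ≠ 0 := by positivity
  have h2 : (p.2.factorial : ℝ) ≠ 0 := by positivity
  have h3 : (n.choose p.1 : ℝ) ≠ 0 := by
    rw [← h]
    exact_mod_cast (Nat.choose_pos (Nat.le_add_right _ _)).ne'
  rw [← h', nsmul_eq_mul]
  field_simp

/-- Associativity of iterated antidiagonal sums. -/
theorem sum_antidiagonal_assoc (f : ℕ → ℕ → ℕ → ℝ) (n : ℕ) :
    ∑ p ∈ antidiagonal n, ∑ q ∈ antidiagonal p.2, f p.1 q.1 q.2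
      = ∑ p ∈ antidiagonal n, ∑ q ∈ antidiagonal p.1, f q.1 q.2 p.2 := by
  rw [Finset.sum_sigma', Finset.sum_sigma']
  refine Finset.sum_bij' (fun x _ => ⟨(x.1.1 + x.2.1, x.2.2), (x.1.1, x.2.1)⟩)
    (fun x _ => ⟨(x.2.1, x.2.2 + x.1.2), (x.2.2, x.1.2)⟩) ?_ ?_ ?_ ?_ ?_ <;>
    rintro ⟨⟨a, b⟩, ⟨c, d⟩⟩ h <;> simp only [mem_sigma, HasAntidiagonal.mem_antidiagonal] at h ⊢
  · simp only [and_true]; omega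
  · simp only [and_true]; omega
  · obtain ⟨h1, h2⟩ := h; subst h2; rfl
  · obtain ⟨h1, h2⟩ := h; subst h2; rfl

theorem sum_antidiagonal_left_comm (f : ℕ → ℕ → ℕ → ℝ) (n : ℕ) :
    ∑ p ∈ antidiagonal n, ∑ q ∈ antidiagonal p.2, f p.1 q.1 q.2
      = ∑ p ∈ antidiagonal n, ∑ q ∈ antidiagonal p.2, f q.1 p.1 q.2 := by
  rw [sum_antidiagonal_assoc, sum_antidiagonal_assoc (fun a b c => f b a c)]
  refine Finset.sum_congr rfl fun p _ => ?_
  rw [← Finset.Nat.sum_antidiagonal_swap]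
  rfl

@[simp] theorem betaSeq_zero (c : ℕ → ℝ) : betaSeq c 0 = 1 := by rw [betaSeq]

theorem betaSeq_succ (c : ℕ → ℝ) (n : ℕ) :
    betaSeq c (n + 1)
      = -∑ j ∈ range (n + 1), betaSeq c j * divPow (n + 1 - j) (-c (j + 1)) := by
  rw [betaSeq, ← Finset.sum_neg_distrib, ← Finset.sum_range_reflect,
    Fin.sum_univ_eq_sum_range (fun j => (-1 : ℝ) ^ (j + 2) / (Nat.factorial (j + 1) : ℝ) *
        betaSeq c (n - j) * c (n - j + 1) ^ (j + 1))]
  refine Finset.sum_congr rfl fun j hj => ?_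
  have hj' : j ≤ n := by simpa [Nat.lt_succ_iff] using hj
  rw [show n + 1 - 1 - j = n - j by omega, show n + 1 - (n - j) = j + 1 by omega, divPow,
    neg_pow (c (n - j + 1)), pow_succ (-1 : ℝ) (j + 1)]
  ring

/-- The defining recursion of `betaSeq`, in convolution form. -/
theorem sum_betaSeq_mul_divPow_neg (c : ℕ → ℝ) (n : ℕ) :
    ∑ p ∈ antidiagonal n, betaSeq c p.1 * divPow p.2 (-c (p.1 + 1)) = divPow n 0 := by
  cases n with
  | zero => simp
  | succ n =>
    rw [Finset.Nat.sum_antidiagonal_eq_sum_range_succ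
      (fun i j => betaSeq c i * divPow j (-c (i + 1))), Finset.sum_range_succ, betaSeq_succ,
      divPow_zero_right (Nat.succ_ne_zero n)]
    simp

/-- Convolution with divided powers of `x - y` translates both sides from `y` to `x`, so the
identity need only be checked at one point, for all orders. -/
theorem sum_mul_divPow_sub (b c : ℕ → ℝ) (y x : ℝ)
    (h : ∀ n, ∑ p ∈ antidiagonal n, b p.1 * divPow p.2 (y - c (p.1 + 1)) = divPow n y) (n : ℕ) :
    ∑ p ∈ antidiagonal n, b p.1 * divPow p.2 (x - c (p.1 + 1)) = divPow n x := by
  calc ∑ p ∈ antidiagonal n, b p.1 * divPow p.2 (x - c (p.1 + 1))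
      = ∑ p ∈ antidiagonal n, ∑ q ∈ antidiagonal p.2,
          b p.1 * divPow q.1 (x - y) * divPow q.2 (y - c (p.1 + 1)) := by
        refine Finset.sum_congr rfl fun p _ => ?_
        rw [show x - c (p.1 + 1) = (x - y) + (y - c (p.1 + 1)) by ring, divPow_add,
          Finset.mul_sum]
        exact Finset.sum_congr rfl fun q _ => by ring
    _ = ∑ p ∈ antidiagonal n, divPow p.1 (x - y) * divPow p.2 y := by
        rw [sum_antidiagonal_left_comm
          (fun i j k => b i * divPow j (x - y) * divPow k (y - c (i + 1)))]
        refine Finset.sum_congr rfl fun p _ => ?_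
        rw [← h, Finset.mul_sum]
        exact Finset.sum_congr rfl fun q _ => by ring
    _ = divPow n x := by rw [← divPow_add]; congr 1; ring

/-- Decomposition of `x ^ n / n!` along `betaSeq`. -/
theorem sum_betaSeq_mul_divPow (c : ℕ → ℝ) (n : ℕ) (x : ℝ) :
    ∑ p ∈ antidiagonal n, betaSeq c p.1 * divPow p.2 (x - c (p.1 + 1)) = divPow n x :=
  sum_mul_divPow_sub _ _ 0 x (fun n => by simpa using sum_betaSeq_mul_divPow_neg c n) n

theorem sum_range_betaSeq_mul_divPow (c : ℕ → ℝ) (n : ℕ) (x : ℝ) :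
    ∑ j ∈ range (n + 1), betaSeq c j * divPow (n - j) (x - c (j + 1)) = divPow n x := by
  rw [← sum_betaSeq_mul_divPow c n x, Finset.Nat.sum_antidiagonal_eq_sum_range_succ
      (fun i j => betaSeq c i * divPow j (x - c (i + 1)))]

theorem betaSeq_eq_sub (c : ℕ → ℝ) (n : ℕ) (x : ℝ) :
    betaSeq c n
      = divPow n x - ∑ j ∈ range n, betaSeq c j * divPow (n - j) (x - c (j + 1)) := by
  rw [← sum_range_betaSeq_mul_divPow c n x, Finset.sum_range_succ]
  simp

/-- `betaSeq` is the only solution of its recursion. -/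
theorem eq_betaSeq (b c : ℕ → ℝ) (y : ℝ)
    (h : ∀ n, ∑ p ∈ antidiagonal n, b p.1 * divPow p.2 (y - c (p.1 + 1)) = divPow n y) (n : ℕ) :
    b n = betaSeq c n := by
  induction n using Nat.strong_induction_on with
  | _ n ih =>
    have h1 := h n
    rw [Finset.Nat.sum_antidiagonal_eq_sum_range_succ
      (fun i j => b i * divPow j (y - c (i + 1))), Finset.sum_range_succ] at h1
    rw [betaSeq_eq_sub c n y, ← h1,
      Finset.sum_congr rfl fun j hj => by rw [ih j (Finset.mem_range.1 hj)]]
    simp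

theorem betaSeq_congr {c c' : ℕ → ℝ} (n : ℕ) (h : ∀ i, 1 ≤ i → i ≤ n → c i = c' i) :
    betaSeq c n = betaSeq c' n := by
  induction n using Nat.strong_induction_on with
  | _ n ih =>
    rw [betaSeq_eq_sub c n 0, betaSeq_eq_sub c' n 0]
    congr 1
    refine Finset.sum_congr rfl fun j hj => ?_
    have hj := Finset.mem_range.1 hj
    rw [ih j hj fun i h1 h2 => h i h1 (by omega), h (j + 1) (by omega) (by omega)]

theorem betaSeq_smul (c : ℕ → ℝ) (s : ℝ) (n : ℕ) :
    betaSeq (fun i => s * c i) n = s ^ n * betaSeq c n := by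
  symm
  refine eq_betaSeq (fun n => s ^ n * betaSeq c n) _ 0 (fun n => ?_) n
  have h : ∀ (k : ℕ) (x : ℝ), divPow k (s * x) = s ^ k * divPow k x := fun k x => by
    rw [divPow, divPow, mul_pow, mul_div_assoc]
  have h0 := sum_betaSeq_mul_divPow c n 0
  calc _ = s ^ n * ∑ p ∈ antidiagonal n, betaSeq c p.1 * divPow p.2 (0 - c (p.1 + 1)) := by
        rw [Finset.mul_sum]
        refine Finset.sum_congr rfl fun p hp => ?_
        rw [← HasAntidiagonal.mem_antidiagonal.1 hp, show 0 - s * c (p.1 + 1) = s * (0 - c (p.1 + 1)) by ring, h,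
          pow_add]
        ring
    _ = divPow n 0 := by rw [h0, ← h, mul_zero]

/-- Decomposition of `betaSeq` by the number of points below the level `x`. -/
theorem betaSeq_eq_sum_shift (c : ℕ → ℝ) (x : ℝ) (n : ℕ) :
    betaSeq c n
      = ∑ p ∈ antidiagonal n, divPow p.1 x * betaSeq (fun l => c (p.1 + l) - x) p.2 := by
  symm
  refine eq_betaSeq
    (fun n => ∑ p ∈ antidiagonal n, divPow p.1 x * betaSeq (fun l => c (p.1 + l) - x) p.2)
    c x (fun n => ?_) n
  calc _ = ∑ p ∈ antidiagonal n, ∑ q ∈ antidiagonal p.1,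
          divPow q.1 x * betaSeq (fun l => c (q.1 + l) - x) q.2
            * divPow p.2 (x - c (q.1 + q.2 + 1)) := by
        refine Finset.sum_congr rfl fun p _ => ?_
        rw [Finset.sum_mul]
        refine Finset.sum_congr rfl fun q hq => ?_
        rw [HasAntidiagonal.mem_antidiagonal.1 hq]
    _ = ∑ p ∈ antidiagonal n, divPow p.1 x * divPow p.2 0 := by
        rw [← sum_antidiagonal_assoc (fun i j k => divPow i x
          * betaSeq (fun l => c (i + l) - x) j * divPow k (x - c (i + j + 1)))]
        refine Finset.sum_congr rfl fun p _ => ?_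
        rw [← sum_betaSeq_mul_divPow_neg (fun l => c (p.1 + l) - x) p.2, Finset.mul_sum]
        refine Finset.sum_congr rfl fun q _ => ?_
        rw [show -(c (p.1 + (q.1 + 1)) - x) = x - c (p.1 + q.1 + 1) by
          rw [← add_assoc]; ring]
        ring
    _ = divPow n x := by rw [← divPow_add, add_zero]

theorem betaSeq_eq_zero {c : ℕ → ℝ} (h : c 1 = 0) (n : ℕ) : betaSeq c (n + 1) = 0 := by
  induction n using Nat.strong_induction_on with
  | _ n ih =>
    rw [betaSeq_succ, neg_eq_zero]
    refine Finset.sum_eq_zero fun j hj => ?_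
    have hj := Finset.mem_range.1 hj
    rcases j with _ | j
    · simp [h, divPow_zero_right]
    · rw [ih j (by omega), zero_mul]

/-- Induction through the shift decomposition at `x = c 1`. The term with no point below `c 1` has a
shifted sequence starting at `0` and vanishes for `n ≥ 1`; all others involve smaller orders and
shifted sequences that are again nonnegative and monotone. -/
theorem betaSeq_nonneg (n : ℕ) (c : ℕ → ℝ) (h1 : 0 ≤ c 1) (hc : ∀ i, 1 ≤ i → c i ≤ c (i + 1)) :
    0 ≤ betaSeq c n := by
  induction n using Nat.strong_induction_on generalizing c with
  | _ n ih =>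
    have hm : ∀ i, c 1 ≤ c (i + 1) := fun i => by
      induction i with
      | zero => exact le_rfl
      | succ i hi => exact hi.trans (hc (i + 1) (by omega))
    rw [betaSeq_eq_sum_shift c (c 1) n]
    refine Finset.sum_nonneg fun p hp => ?_
    have hp := HasAntidiagonal.mem_antidiagonal.1 hp
    rcases Nat.eq_zero_or_pos p.1 with h0 | h0
    · rcases n with _ | n
      · have h2 : p.2 = 0 := by omega
        simp [h0, h2]
      · have h2 : p.2 = n + 1 := by omega
        rw [h2, betaSeq_eq_zero (by simp [h0]), mul_zero]
    · exact mul_nonneg (divPow_nonneg _ h1) (ih _ (by omega) _ (by simpa using hm p.1)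
        fun i _ => by simpa [add_assoc] using hc (p.1 + i) (by omega))

/-- One term of a decomposition into nonnegative terms. It discards the first `i` levels, so that
the later, almost affine ones can be bounded below. -/
theorem divPow_mul_betaSeq_shift_le (c : ℕ → ℝ) (h1 : 0 ≤ c 1)
    (hc : ∀ i, 1 ≤ i → c i ≤ c (i + 1)) (i j : ℕ) :
    divPow i (c 1) * betaSeq (fun l => c (i + l) - c 1) j ≤ betaSeq c (i + j) := by
  rw [betaSeq_eq_sum_shift c (c 1) (i + j)]
  have hm : ∀ i, c 1 ≤ c (i + 1) := fun i => by
    induction i with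
    | zero => exact le_rfl
    | succ i hi => exact hi.trans (hc (i + 1) (by omega))
  refine Finset.single_le_sum
    (f := fun p : ℕ × ℕ => divPow p.1 (c 1) * betaSeq (fun l => c (p.1 + l) - c 1) p.2)
    (fun p hp => ?_) (a := (i, j)) (by simp)
  refine mul_nonneg (divPow_nonneg _ h1) ?_
  rcases Nat.eq_zero_or_pos p.1 with h0 | h0
  · rcases p.2 with _ | n
    · simp
    · rw [betaSeq_eq_zero (by simp [h0])]
  · exact betaSeq_nonneg _ _ (by simpa using hm p.1)
        fun i _ => by simpa [add_assoc] using hc (p.1 + i) (by omega)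

/-! ### Abel coefficients and their asymptotics -/

/-- The coefficients `(n + t) ^ (n - 1) / n!` of the Abel polynomials. -/
noncomputable def abelCoeff (n : ℕ) (t : ℝ) : ℝ := ((n : ℝ) + t) ^ (n - 1) / (n.factorial : ℝ)

theorem mul_abelCoeff {n : ℕ} (hn : 1 ≤ n) (t : ℝ) :
    t * abelCoeff n t = divPow n (n + t) - divPow (n - 1) (n + t) := by
  obtain ⟨k, rfl⟩ := Nat.exists_eq_add_of_le' hn
  simp only [abelCoeff, divPow, Nat.add_sub_cancel, Nat.factorial_succ, pow_succ]
  have : (k.factorial : ℝ) ≠ 0 := by positivity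
  push_cast
  field_simp
  ring

/-- Comparison of `betaSeq` for a perturbed affine sequence with the Abel polynomial of an
arbitrary affine sequence. -/
theorem betaSeq_cSeq_eq (θ t : ℝ) (d : ℕ → ℝ) {n : ℕ} (hn : 1 ≤ n) :
    betaSeq (cSeq θ d) n = t * abelCoeff n t - ∑ j ∈ range n, betaSeq (cSeq θ d) j *
      ((t - θ - d (j + 1)) * abelCoeff (n - j) (t - θ - d (j + 1))) := by
  -- Both orders are evaluated at the same point `n + t`, so that the difference of divided powers
  -- is an Abel term by `mul_abelCoeff`, on the left and inside the sum.
  have h1 := sum_range_betaSeq_mul_divPow (cSeq θ d) n (n + t)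
  have h2 := sum_range_betaSeq_mul_divPow (cSeq θ d) (n - 1) (n + t)
  rw [Finset.sum_range_succ] at h1
  rw [Nat.sub_add_cancel hn] at h2
  have h3 : ∑ j ∈ range n, betaSeq (cSeq θ d) j *
      ((t - θ - d (j + 1)) * abelCoeff (n - j) (t - θ - d (j + 1)))
      = ∑ j ∈ range n, betaSeq (cSeq θ d) j * divPow (n - j) (n + t - cSeq θ d (j + 1))
        - ∑ j ∈ range n, betaSeq (cSeq θ d) j * divPow (n - 1 - j) (n + t - cSeq θ d (j + 1)) := by
    rw [← Finset.sum_sub_distrib]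
    refine Finset.sum_congr rfl fun j hj => ?_
    have hj := Finset.mem_range.1 hj
    rw [mul_abelCoeff (by omega), mul_sub, show n - j - 1 = n - 1 - j by omega]
    have : ((n - j : ℕ) : ℝ) + (t - θ - d (j + 1)) = n + t - cSeq θ d (j + 1) := by
      rw [Nat.cast_sub hj.le, cSeq]; push_cast; ring
    rw [this]
  rw [h3, h2, mul_abelCoeff hn, ← h1]
  simp

theorem tendsto_one_add_div_pow {ι : Type*} {l : Filter ι} {n : ι → ℕ} {t : ι → ℝ} {t₀ : ℝ}
    (hn : Tendsto n l atTop) (ht : Tendsto t l (𝓝 t₀)) :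
    Tendsto (fun i => (1 + t i / n i) ^ n i) l (𝓝 (Real.exp t₀)) := by
  have hn' : Tendsto (fun i => (n i : ℝ)) l atTop := tendsto_natCast_atTop_atTop.comp hn
  have h0 : Tendsto (fun i => t i / n i) l (𝓝 0) := ht.div_atTop hn'
  have h1 : Tendsto (fun i => 1 + t i / n i) l (𝓝 1) := by simpa using h0.const_add 1
  have hpos : ∀ᶠ i in l, 0 < 1 + t i / n i := h1.eventually (lt_mem_nhds one_pos)
  have hn0 : ∀ᶠ i in l, (0 : ℝ) < n i := hn'.eventually_gt_atTop 0
  have hlog : Tendsto (fun i => n i * Real.log (1 + t i / n i)) l (𝓝 t₀) := by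
    have hlow : Tendsto (fun i => t i / (1 + t i / n i)) l (𝓝 t₀) := by
      have := ht.div h1 one_ne_zero
      rwa [div_one] at this
    refine tendsto_of_tendsto_of_tendsto_of_le_of_le' hlow ht ?_ ?_
    · filter_upwards [hpos, hn0] with i hi hni
      calc t i / (1 + t i / n i) = n i * (1 - (1 + t i / n i)⁻¹) := by
            have := hi.ne'
            rw [eq_comm, ← sub_eq_zero]
            generalize hx : 1 + t i / n i = x at *
            have ht' : t i = n i * (x - 1) := by rw [← hx]; field_simp; ring
            rw [ht']; field_simp; ring
        _ ≤ _ := by gcongr; exact Real.one_sub_inv_le_log_of_pos hi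
    · filter_upwards [hpos, hn0] with i hi hni
      calc n i * Real.log (1 + t i / n i) ≤ n i * (1 + t i / n i - 1) := by
            gcongr; exact Real.log_le_sub_one_of_pos hi
        _ = t i := by field_simp; ring
  refine ((Real.continuous_exp.tendsto _).comp hlog).congr' ?_
  filter_upwards [hpos] with i hi
  rw [Function.comp, Real.exp_nat_mul, Real.exp_log hi]

/-- Stirling's formula. -/
theorem tendsto_factorial_div :
    Tendsto (fun n : ℕ => (n.factorial : ℝ) * Real.exp n / ((n : ℝ) ^ n * √n)) atTop
      (𝓝 √(2 * Real.pi)) := by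
  have h := Stirling.tendsto_stirlingSeq_sqrt_pi.const_mul √2
  rw [← Real.sqrt_mul (by norm_num)] at h
  refine h.congr fun n => ?_
  rw [Stirling.stirlingSeq, Real.sqrt_mul (by norm_num), div_pow,
    ← Real.exp_nat_mul, mul_one]
  have : √(2 : ℝ) ≠ 0 := by positivity
  have : Real.exp n ≠ 0 := by positivity
  field_simp

theorem tendsto_abelCoeff {ι : Type*} {l : Filter ι} {n : ι → ℕ} {t : ι → ℝ} {t₀ : ℝ}
    (hn : Tendsto n l atTop) (ht : Tendsto t l (𝓝 t₀)) :
    Tendsto (fun i => abelCoeff (n i) (t i) * Real.exp (-n i) * (n i * √(n i))) l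
      (𝓝 (Real.exp t₀ / √(2 * Real.pi))) := by
  have hn' : Tendsto (fun i => (n i : ℝ)) l atTop := tendsto_natCast_atTop_atTop.comp hn
  have h0 : Tendsto (fun i => t i / n i) l (𝓝 0) := ht.div_atTop hn'
  have h1 : Tendsto (fun i => 1 + t i / n i) l (𝓝 1) := by simpa using h0.const_add 1
  have h := ((tendsto_one_add_div_pow hn ht).div (tendsto_factorial_div.comp hn)
    (by positivity)).div h1 one_ne_zero
  rw [div_one] at h
  refine h.congr' ?_
  filter_upwards [h1.eventually (lt_mem_nhds one_pos), hn.eventually_ge_atTop 1] with i hi hni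
  obtain ⟨k, hk⟩ := Nat.exists_eq_add_of_le' hni
  have hpos : (0 : ℝ) < n i := by exact_mod_cast hni
  have e : (n i : ℝ) + t i = n i * (1 + t i / n i) := by field_simp
  simp only [abelCoeff, Function.comp, Pi.div_apply]
  rw [e, mul_pow, Real.exp_neg]
  generalize 1 + t i / n i = x at hi ⊢
  rw [hk] at hpos ⊢
  have hs : √((k + 1 : ℕ) : ℝ) ^ 2 = ((k + 1 : ℕ) : ℝ) := Real.sq_sqrt hpos.le
  have h3 : Real.exp ((k + 1 : ℕ) : ℝ) ≠ 0 := by positivity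
  have h4 : √((k + 1 : ℕ) : ℝ) ≠ 0 := by positivity
  have h5 : ((k + 1).factorial : ℝ) ≠ 0 := by positivity
  simp only [Nat.add_sub_cancel, pow_succ]
  field_simp

/-! ### Uniform bounds by `exp n * wt n` -/

/-- The summable weights `(n + 1) ^ (-3/2)`. -/
noncomputable def wt (n : ℕ) : ℝ := (((n : ℝ) + 1) * √((n : ℝ) + 1))⁻¹

theorem wt_pos (n : ℕ) : 0 < wt n := by unfold wt; positivity

theorem wt_antitone : Antitone wt := fun a b h => by
  have : (a : ℝ) ≤ b := by exact_mod_cast h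
  unfold wt
  gcongr

theorem summable_wt : Summable wt := by
  have h := (summable_nat_add_iff 1).2 (Real.summable_nat_rpow_inv.2 (by norm_num : 1 < (3 / 2 : ℝ)))
  refine h.congr fun n => ?_
  have : (0 : ℝ) < (n : ℝ) + 1 := by positivity
  rw [wt, show (3 / 2 : ℝ) = 1 + 1 / 2 by norm_num]
  push_cast
  rw [Real.rpow_add this, Real.rpow_one, Real.sqrt_eq_rpow]

/-- The larger index is at least half of `a + b`, so its weight is comparable with `wt (a + b)`; the
constant is 2^(3/2), rounded up to 4. This makes the convolution in the recursion summable after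
division by `wt (a + b)`. -/
theorem wt_mul_le (a b : ℕ) : wt a * wt b ≤ 4 * (wt a + wt b) * wt (a + b) := by
  wlog h : a ≤ b generalizing a b
  · have := this b a (le_of_not_ge h)
    rw [add_comm b a] at this
    linarith
  have h1 : wt b ≤ 4 * wt (a + b) := by
    have hab : (a : ℝ) ≤ b := by exact_mod_cast h
    have h0 : (0 : ℝ) ≤ a := by positivity
    unfold wt
    rw [← div_eq_mul_inv, inv_le_comm₀ (by positivity) (by positivity), inv_div,
      div_le_iff₀ (by norm_num)]
    push_cast
    have h2 : √((a : ℝ) + b + 1) ≤ 2 * √((b : ℝ) + 1) := by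
      rw [Real.sqrt_le_left (by positivity), mul_pow, Real.sq_sqrt (by positivity)]
      linarith
    calc ((a : ℝ) + b + 1) * √((a : ℝ) + b + 1) ≤ (2 * ((b : ℝ) + 1)) * (2 * √((b : ℝ) + 1)) := by
          gcongr; linarith
      _ = _ := by ring
  have := wt_pos a
  have := wt_pos b
  have := wt_pos (a + b)
  nlinarith [mul_le_mul_of_nonneg_left h1 (wt_pos a).le]

theorem abelCoeff_pos (n : ℕ) {t : ℝ} (ht : 0 ≤ t) : 0 < abelCoeff n t := by
  unfold abelCoeff
  rcases n with _ | n
  · simp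
  · positivity

theorem abs_abelCoeff_neg_le (n : ℕ) {x B : ℝ} (h : |x| ≤ B) :
    |abelCoeff n (-x)| ≤ abelCoeff n B := by
  unfold abelCoeff
  rw [abs_div, abs_pow, Nat.abs_cast]
  gcongr
  calc |(n : ℝ) + -x| ≤ |(n : ℝ)| + |-x| := abs_add_le _ _
    _ ≤ n + B := by rw [abs_neg, Nat.abs_cast]; gcongr

/-- The ratio is positive and has a positive limit, so the ratio and its inverse are bounded over
all `n`. -/
theorem exists_abelCoeff_bounds {t : ℝ} (ht : 0 ≤ t) :
    ∃ C : ℝ, 0 < C ∧ ∀ n : ℕ, abelCoeff n t ≤ C * (Real.exp n * wt n) ∧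
      Real.exp n * wt n ≤ C * abelCoeff n t := by
  have h1 : Tendsto (fun n : ℕ => abelCoeff n t / (Real.exp n * wt n)) atTop
      (𝓝 (Real.exp t / √(2 * Real.pi))) := by
    have h2 : Tendsto (fun n : ℕ => 1 + 1 / (n : ℝ)) atTop (𝓝 1) := by
      simpa using (tendsto_const_div_atTop_nhds_zero_nat (1 : ℝ)).const_add 1
    have h3 := (tendsto_abelCoeff tendsto_id (tendsto_const_nhds (x := t))).mul
      (h2.mul h2.sqrt)
    simp only [Real.sqrt_one, mul_one] at h3
    refine h3.congr' ?_
    filter_upwards [eventually_ge_atTop 1] with n hn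
    have hn' : (0 : ℝ) < n := by exact_mod_cast hn
    have e : 1 + 1 / (n : ℝ) = (n + 1) / n := by field_simp
    rw [e, Real.sqrt_div (by positivity), wt, Real.exp_neg]
    simp only [id]
    have : √(n : ℝ) ≠ 0 := by positivity
    field_simp
  have hpos : ∀ n : ℕ, 0 < abelCoeff n t / (Real.exp n * wt n) := fun n =>
    div_pos (abelCoeff_pos n ht) (mul_pos (Real.exp_pos _) (wt_pos n))
  obtain ⟨C₁, hC₁⟩ := h1.bddAbove_range
  obtain ⟨C₂, hC₂⟩ := (h1.inv₀ (by positivity)).bddAbove_range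
  refine ⟨max C₁ C₂, lt_max_of_lt_left ((hpos 0).trans_le (hC₁ ⟨0, rfl⟩)), fun n => ⟨?_, ?_⟩⟩
  · rw [← div_le_iff₀ (mul_pos (Real.exp_pos _) (wt_pos n))]
    exact (hC₁ ⟨n, rfl⟩).trans (le_max_left _ _)
  · have := hC₂ ⟨n, rfl⟩
    simp only [inv_div] at this
    rw [← div_le_iff₀ (abelCoeff_pos n ht)]
    exact this.trans (le_max_right _ _)

/-- Perturbations bounded by `B` of an affine sequence that stay nonnegative and monotone. -/
structure Admissible (θ B : ℝ) (d : ℕ → ℝ) : Prop where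
  nonneg : 0 ≤ cSeq θ d 1
  mono : ∀ i, 1 ≤ i → cSeq θ d i ≤ cSeq θ d (i + 1)
  bound : ∀ j, |d (j + 1)| ≤ B

theorem Admissible.betaSeq_nonneg {θ B : ℝ} {d : ℕ → ℝ} (h : Admissible θ B d) (n : ℕ) :
    0 ≤ betaSeq (cSeq θ d) n := Cascade.betaSeq_nonneg n _ h.nonneg h.mono

theorem exists_betaSeq_le {θ B : ℝ} (hθ : 0 < θ) (hB : 0 ≤ B) :
    ∃ C : ℝ, 0 < C ∧ ∀ d, Admissible θ B d → ∀ n,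
      betaSeq (cSeq θ d) n ≤ C * (Real.exp n * wt n) := by
  obtain ⟨C, hC, h⟩ := exists_abelCoeff_bounds (add_pos_of_pos_of_nonneg hθ hB).le
  -- The Abel comparison with `t = θ + B` subtracts only nonnegative terms, since `t - θ - d (j + 1)
  -- ≥ 0`. The `1` in the maximum covers `n = 0`.
  refine ⟨max 1 (θ + B) * C, by positivity, fun d hd n => ?_⟩
  have h1 : betaSeq (cSeq θ d) n ≤ max 1 (θ + B) * abelCoeff n (θ + B) := by
    rcases n with _ | n
    · simp [abelCoeff]
    · calc betaSeq (cSeq θ d) (n + 1) ≤ (θ + B) * abelCoeff (n + 1) (θ + B) := by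
            rw [betaSeq_cSeq_eq θ (θ + B) d (Nat.succ_pos n), sub_le_self_iff]
            refine Finset.sum_nonneg fun j _ => mul_nonneg (hd.betaSeq_nonneg j) ?_
            have : 0 ≤ θ + B - θ - d (j + 1) := by
              have := (abs_le.1 (hd.bound j)).2
              linarith
            exact mul_nonneg this (abelCoeff_pos _ this).le
        _ ≤ _ := mul_le_mul_of_nonneg_right (le_max_right _ _) (abelCoeff_pos _ (by positivity)).le
  calc _ ≤ _ := h1
    _ ≤ max 1 (θ + B) * (C * (Real.exp n * wt n)) := by
        gcongr
        exact (h n).1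
    _ = _ := by ring

/-! ### The limit of β over the Abel coefficients -/

/-- The terms of the recursion for `betaSeq (cSeq θ d) m / abelCoeff m θ`. -/
noncomputable def ratioTerm (θ : ℝ) (d : ℕ → ℝ) (m j : ℕ) : ℝ :=
  betaSeq (cSeq θ d) j * (d (j + 1) * abelCoeff (m - j) (-d (j + 1))) / abelCoeff m θ

theorem betaSeq_div_abelCoeff {θ : ℝ} (hθ : 0 < θ) (d : ℕ → ℝ) {m : ℕ} (hm : 1 ≤ m) :
    betaSeq (cSeq θ d) m / abelCoeff m θ = θ + ∑ j ∈ range m, ratioTerm θ d m j := by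
  have h := (abelCoeff_pos m hθ.le).ne'
  rw [div_eq_iff h, add_mul, betaSeq_cSeq_eq θ θ d hm, Finset.sum_mul, sub_eq_add_neg,
    ← Finset.sum_neg_distrib]
  congr 1
  refine Finset.sum_congr rfl fun j _ => ?_
  rw [ratioTerm, div_mul_cancel₀ _ h, sub_self, zero_sub]
  ring

theorem exists_abs_ratioTerm_le {θ B : ℝ} (hθ : 0 < θ) (hB : 0 ≤ B) :
    ∃ C : ℝ, 0 < C ∧ ∀ d, Admissible θ B d → ∀ m j, j ≤ m →
      |ratioTerm θ d m j| ≤ C * |d (j + 1)| * (wt j + wt (m - j)) := by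
  obtain ⟨C₁, hC₁, h₁⟩ := exists_betaSeq_le hθ hB
  obtain ⟨C₂, hC₂, h₂⟩ := exists_abelCoeff_bounds hB
  obtain ⟨C₃, hC₃, h₃⟩ := exists_abelCoeff_bounds hθ.le
  refine ⟨4 * C₁ * C₂ * C₃, by positivity, fun d hd m j hj => ?_⟩
  obtain ⟨i, rfl⟩ := Nat.exists_eq_add_of_le hj
  rw [Nat.add_sub_cancel_left, ratioTerm, Nat.add_sub_cancel_left, abs_div, abs_mul, abs_mul,
    abs_of_pos (abelCoeff_pos (j + i) hθ.le), abs_of_nonneg (hd.betaSeq_nonneg j),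
    div_le_iff₀ (abelCoeff_pos (j + i) hθ.le)]
  have ha : |abelCoeff i (-d (j + 1))| ≤ C₂ * (Real.exp i * wt i) :=
    (abs_abelCoeff_neg_le i (hd.bound j)).trans (h₂ i).1
  have hw := wt_mul_le j i
  have w1 := wt_pos j
  have w2 := wt_pos i
  calc betaSeq (cSeq θ d) j * (|d (j + 1)| * |abelCoeff i (-d (j + 1))|)
      ≤ C₁ * (Real.exp j * wt j) * (|d (j + 1)| * (C₂ * (Real.exp i * wt i))) := by
        gcongr
        exact h₁ d hd j
    _ = C₁ * C₂ * |d (j + 1)| * Real.exp (j + i) * (wt j * wt i) := by rw [Real.exp_add]; ring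
    _ ≤ C₁ * C₂ * |d (j + 1)| * Real.exp (j + i) * (4 * (wt j + wt i) * wt (j + i)) := by gcongr
    _ = 4 * C₁ * C₂ * |d (j + 1)| * (wt j + wt i) * (Real.exp ((j + i : ℕ) : ℝ) * wt (j + i)) := by
        push_cast; ring
    _ ≤ 4 * C₁ * C₂ * |d (j + 1)| * (wt j + wt i) * (C₃ * abelCoeff (j + i) θ) :=
        mul_le_mul_of_nonneg_left (h₃ (j + i)).2 (by positivity)
    _ = _ := by ring

theorem tendsto_betaSeq {ι : Type*} {l : Filter ι} {c : ι → ℕ → ℝ} {c₀ : ℕ → ℝ}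
    (h : ∀ j, Tendsto (fun i => c i (j + 1)) l (𝓝 (c₀ (j + 1)))) (n : ℕ) :
    Tendsto (fun i => betaSeq (c i) n) l (𝓝 (betaSeq c₀ n)) := by
  induction n using Nat.strong_induction_on with
  | _ n ih =>
    simp_rw [fun c => betaSeq_eq_sub c n 0]
    refine tendsto_const_nhds.sub (tendsto_finsetSum _ fun j hj => ?_)
    refine (ih j (Finset.mem_range.1 hj)).mul ?_
    exact (((h j).const_sub 0).pow _).div_const _

/-- The terms of the limit of `betaSeq (cSeq θ d) m / abelCoeff m θ`. -/
noncomputable def limitTerm (θ : ℝ) (d : ℕ → ℝ) (j : ℕ) : ℝ :=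
  betaSeq (cSeq θ d) j * (d (j + 1) * Real.exp (-cSeq θ d (j + 1)))

theorem tendsto_sub_const_nat {ι : Type*} {l : Filter ι} {m : ι → ℕ} (hm : Tendsto m l atTop)
    (j : ℕ) : Tendsto (fun i => m i - j) l atTop := (tendsto_sub_atTop_nat j).comp hm

theorem tendsto_abelCoeff_ratio {ι : Type*} {l : Filter ι} {m : ι → ℕ} {t : ι → ℝ} {t₀ : ℝ}
    (θ : ℝ) (hm : Tendsto m l atTop) (ht : Tendsto t l (𝓝 t₀)) (j : ℕ) :
    Tendsto (fun i => abelCoeff (m i - j) (t i) / abelCoeff (m i) θ) l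
      (𝓝 (Real.exp (t₀ - θ - j))) := by
  have hm' : Tendsto (fun i => (m i : ℝ)) l atTop := tendsto_natCast_atTop_atTop.comp hm
  have hr : Tendsto (fun i => 1 - (j : ℝ) / m i) l (𝓝 1) := by
    simpa using (tendsto_const_nhds (x := (j : ℝ)).div_atTop hm').const_sub 1
  have h := (((tendsto_abelCoeff (tendsto_sub_const_nat hm j) ht).div
    (tendsto_abelCoeff hm (tendsto_const_nhds (x := θ))) (by positivity)).mul_const
      (Real.exp (-j))).div (hr.mul hr.sqrt) (by simp)
  have e : Real.exp t₀ / √(2 * Real.pi) / (Real.exp θ / √(2 * Real.pi)) * Real.exp (-j) / (1 * √1)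
      = Real.exp (t₀ - θ - j) := by
    have : √(2 * Real.pi) ≠ 0 := by positivity
    rw [sub_eq_add_neg, Real.exp_add, Real.exp_sub]
    simp only [Real.sqrt_one]
    field_simp
  rw [e] at h
  refine h.congr' ?_
  filter_upwards [hm.eventually_gt_atTop j] with i hi
  have h1 : (0 : ℝ) < m i := by exact_mod_cast (Nat.zero_le j).trans_lt hi
  have h2 : (0 : ℝ) < (m i - j : ℕ) := by exact_mod_cast Nat.sub_pos_of_lt hi
  have h3 : ((m i - j : ℕ) : ℝ) = (m i : ℝ) - j := Nat.cast_sub hi.le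
  have e1 : 1 - (j : ℝ) / m i = (m i - j : ℕ) / m i := by rw [h3]; field_simp
  have e2 : Real.exp (-(m i - j : ℕ)) = Real.exp (-m i) * Real.exp j := by
    rw [h3, ← Real.exp_add]; congr 1; ring
  simp only [Pi.div_apply]
  rw [e1, e2, Real.sqrt_div h2.le, Real.exp_neg, Real.exp_neg]
  have : √(m i : ℝ) ≠ 0 := by positivity
  have : √((m i - j : ℕ) : ℝ) ≠ 0 := by positivity
  field_simp

theorem tendsto_ratioTerm {ι : Type*} {l : Filter ι} {θ : ℝ} {d : ι → ℕ → ℝ} {D : ℕ → ℝ}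
    {m : ι → ℕ} (hm : Tendsto m l atTop)
    (hd : ∀ j, Tendsto (fun i => d i (j + 1)) l (𝓝 (D (j + 1)))) (j : ℕ) :
    Tendsto (fun i => ratioTerm θ (d i) (m i) j) l (𝓝 (limitTerm θ D j)) := by
  have h1 : Tendsto (fun i => betaSeq (cSeq θ (d i)) j) l (𝓝 (betaSeq (cSeq θ D) j)) :=
    tendsto_betaSeq (fun j => (hd j).const_add _) j
  have h2 := tendsto_abelCoeff_ratio θ hm (hd j).neg j
  have e : -D (j + 1) - θ - j = -cSeq θ D (j + 1) := by rw [cSeq]; push_cast; ring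
  rw [e] at h2
  refine (h1.mul ((hd j).mul h2)).congr fun i => ?_
  rw [ratioTerm]
  ring

theorem Admissible.of_tendsto {ι : Type*} {l : Filter ι} [l.NeBot] {θ B : ℝ} {d : ι → ℕ → ℝ}
    {D : ℕ → ℝ} (h : ∀ᶠ i in l, Admissible θ B (d i))
    (hd : ∀ j, Tendsto (fun i => d i (j + 1)) l (𝓝 (D (j + 1)))) : Admissible θ B D := by
  have hc : ∀ j, 1 ≤ j → Tendsto (fun i => cSeq θ (d i) j) l (𝓝 (cSeq θ D j)) := fun j hj => by
    obtain ⟨k, rfl⟩ := Nat.exists_eq_add_of_le' hj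
    exact (hd k).const_add _
  refine ⟨ge_of_tendsto (hc 1 le_rfl) (h.mono fun i hi => hi.nonneg), fun j hj => ?_, fun j => ?_⟩
  · exact le_of_tendsto_of_tendsto (hc j hj) (hc (j + 1) (by omega))
      (h.mono fun i hi => hi.mono j hj)
  · exact le_of_tendsto (hd j).abs (h.mono fun i hi => hi.bound j)

theorem Admissible.summable_limitTerm {θ B : ℝ} {d : ℕ → ℝ} (hθ : 0 < θ) (hB : 0 ≤ B)
    (h : Admissible θ B d) : Summable (limitTerm θ d) := by
  obtain ⟨C, hC, hβ⟩ := exists_betaSeq_le hθ hB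
  refine Summable.of_norm_bounded (g := fun j => C * B * Real.exp (B - θ) * wt j)
    (summable_wt.mul_left _) fun j => ?_
  have hd := h.bound j
  have w := wt_pos j
  rw [limitTerm, Real.norm_eq_abs, abs_mul, abs_mul, abs_of_nonneg (h.betaSeq_nonneg j),
    abs_of_pos (Real.exp_pos _)]
  calc betaSeq (cSeq θ d) j * (|d (j + 1)| * Real.exp (-cSeq θ d (j + 1)))
      ≤ C * (Real.exp j * wt j) * (B * Real.exp (B - θ - j)) := by
        gcongr
        · exact hβ d h j
        · rw [cSeq]
          push_cast
          linarith [(abs_le.1 hd).1]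
    _ = C * B * (Real.exp j * Real.exp (B - θ - j)) * wt j := by ring
    _ = _ := by rw [← Real.exp_add]; congr 3; ring

/-- The limit of `betaSeq (cSeq θ d) m / abelCoeff m θ`. -/
noncomputable def ratioLimit (θ : ℝ) (d : ℕ → ℝ) : ℝ := θ + ∑' j, limitTerm θ d j

theorem tendsto_betaSeq_div_abelCoeff {ι : Type*} {l : Filter ι} [l.NeBot] {θ B : ℝ}
    (hθ : 0 < θ) (hB : 0 ≤ B) {d : ι → ℕ → ℝ} {D : ℕ → ℝ} {m : ι → ℕ} (hm : Tendsto m l atTop)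
    (h : ∀ᶠ i in l, Admissible θ B (d i))
    (hd : ∀ j, Tendsto (fun i => d i (j + 1)) l (𝓝 (D (j + 1))))
    (hunif : ∀ ε > 0, ∃ J, ∀ᶠ i in l, ∀ j, J ≤ j → |d i (j + 1)| ≤ ε) :
    Tendsto (fun i => betaSeq (cSeq θ (d i)) (m i) / abelCoeff (m i) θ) l
      (𝓝 (ratioLimit θ D)) := by
  obtain ⟨C, hC, hterm⟩ := exists_abs_ratioTerm_le hθ hB
  have hsum := (Admissible.of_tendsto h hd).summable_limitTerm hθ hB
  set U := ∑' j, wt j with hU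
  -- The bound `wt j + wt (m - j)` has no summable majorant independent of `m`, but its sum over `j
  -- < m` is at most `2 * U`. Smallness of the tail therefore has to come from the uniform smallness
  -- of `d`, whence the threshold `ε / (3 * (C * (2 * U)))`.
  have hU0 : 0 < U := summable_wt.tsum_pos (fun j => (wt_pos j).le) 0 (wt_pos 0)
  have hUle : ∀ s : Finset ℕ, ∑ j ∈ s, wt j ≤ U := fun s =>
    summable_wt.sum_le_tsum s fun j _ => (wt_pos j).le
  rw [Metric.tendsto_nhds]
  intro ε hε
  obtain ⟨J₁, hJ₁⟩ := hunif (ε / (3 * (C * (2 * U)))) (by positivity)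
  have hpart := hsum.hasSum.tendsto_sum_nat.eventually
    (Metric.ball_mem_nhds _ (by positivity : 0 < ε / 3))
  obtain ⟨J, hJ, hJJ⟩ := (hpart.and (eventually_ge_atTop J₁)).exists
  have hhead : Tendsto (fun i => ∑ j ∈ range J, ratioTerm θ (d i) (m i) j) l
      (𝓝 (∑ j ∈ range J, limitTerm θ D j)) :=
    tendsto_finsetSum _ fun j _ => tendsto_ratioTerm hm hd j
  filter_upwards [h, hJ₁, hhead.eventually (Metric.ball_mem_nhds _ (by positivity : 0 < ε / 3)),
    hm.eventually_ge_atTop (J + 1)] with i hi hi1 hi2 hi3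
  have htail : |∑ j ∈ Finset.Ico J (m i), ratioTerm θ (d i) (m i) j| ≤ ε / 3 := by
    calc |∑ j ∈ Finset.Ico J (m i), ratioTerm θ (d i) (m i) j|
        ≤ ∑ j ∈ Finset.Ico J (m i), |ratioTerm θ (d i) (m i) j| := Finset.abs_sum_le_sum_abs _ _
      _ ≤ ∑ j ∈ Finset.Ico J (m i),
            -- Lowering the index to `m i - 1 - j` only increases the weight and makes it the
            -- reflection of `wt j` on `range (m i)`.
            C * (ε / (3 * (C * (2 * U)))) * (wt j + wt (m i - 1 - j)) := by
          refine Finset.sum_le_sum fun j hj => ?_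
          have hj := Finset.mem_Ico.1 hj
          have h1 := hi1 j (hJJ.trans hj.1)
          have w1 := wt_pos j
          have w2 := wt_pos (m i - j)
          have w3 : wt (m i - j) ≤ wt (m i - 1 - j) := wt_antitone (by omega)
          exact (hterm _ hi _ _ hj.2.le).trans (by gcongr)
      _ ≤ ∑ j ∈ Finset.range (m i),
            C * (ε / (3 * (C * (2 * U)))) * (wt j + wt (m i - 1 - j)) := by
          refine Finset.sum_le_sum_of_subset_of_nonneg (fun j hj => ?_) fun j _ _ => ?_
          · exact Finset.mem_range.2 (Finset.mem_Ico.1 hj).2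
          · have w1 := wt_pos j
            have w2 := wt_pos (m i - 1 - j)
            positivity
      _ = C * (ε / (3 * (C * (2 * U)))) *
            (∑ j ∈ Finset.range (m i), wt j + ∑ j ∈ Finset.range (m i), wt j) := by
          rw [← Finset.mul_sum, Finset.sum_add_distrib, Finset.sum_range_reflect wt]
      _ ≤ C * (ε / (3 * (C * (2 * U)))) * (U + U) := by gcongr <;> exact hUle _
      _ = ε / 3 := by field_simp; ring
  rw [betaSeq_div_abelCoeff hθ _ (by omega),
    ← Finset.sum_range_add_sum_Ico _ (by omega : J ≤ m i), Real.dist_eq, ratioLimit]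
  rw [Real.dist_eq] at hi2 hJ
  rw [abs_lt] at hi2 hJ ⊢
  rw [abs_le] at htail
  constructor <;> linarith [hi2.1, hi2.2, hJ.1, hJ.2, htail.1, htail.2]

/-! ### Positivity of the limit -/

/-- In the Abel comparison the arguments `t - θ - d (j + 1)` lie in `[-1, 0]`. They are nonpositive
while `n - j` plus the argument stays nonnegative, so every subtracted term is nonpositive. -/
theorem le_betaSeq_cSeq {θ t : ℝ} {d : ℕ → ℝ} (h0 : 0 ≤ cSeq θ d 1)
    (hmono : ∀ i, 1 ≤ i → cSeq θ d i ≤ cSeq θ d (i + 1))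
    (hd : ∀ j, θ + d (j + 1) - t ∈ Set.Icc 0 1) {n : ℕ} (hn : 1 ≤ n) :
    t * abelCoeff n t ≤ betaSeq (cSeq θ d) n := by
  rw [betaSeq_cSeq_eq θ t d hn, le_sub_self_iff]
  refine Finset.sum_nonpos fun j hj => ?_
  have hj := Finset.mem_range.1 hj
  obtain ⟨h1, h2⟩ := hd j
  refine mul_nonpos_of_nonneg_of_nonpos (betaSeq_nonneg j _ h0 hmono)
    (mul_nonpos_of_nonpos_of_nonneg (by linarith) ?_)
  have h3 : (1 : ℝ) ≤ (n - j : ℕ) := by exact_mod_cast (by omega : 1 ≤ n - j)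
  unfold abelCoeff
  refine div_nonneg (pow_nonneg ?_ _) (by positivity)
  linarith

/-- Placing `i` points below `c 1 > 0` leaves a sequence whose perturbations are at most `1/2`,
which is bounded below by an Abel term. Relative to `abelCoeff n θ`, that term has a positive
exponential limit. -/
theorem ratioLimit_pos {θ B : ℝ} {D : ℕ → ℝ} (hθ : 0 < θ) (hB : 0 ≤ B) (h : Admissible θ B D)
    (h1 : 0 < cSeq θ D 1) (hD : Tendsto D atTop (𝓝 0)) : 0 < ratioLimit θ D := by
  have hsmall : ∀ ε > 0, ∃ J : ℕ, ∀ j, J ≤ j → |D j| ≤ ε := fun ε hε => by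
    obtain ⟨J, hJ⟩ := eventually_atTop.1 (hD.eventually (Metric.ball_mem_nhds 0 hε))
    refine ⟨J, fun j hj => ?_⟩
    have := hJ j hj
    rw [Real.dist_0_eq_abs] at this
    exact this.le
  have hlim := tendsto_betaSeq_div_abelCoeff (l := atTop) hθ hB (d := fun _ : ℕ => D)
    (m := id) tendsto_id (Eventually.of_forall fun _ => h) (fun j => tendsto_const_nhds)
    (fun ε hε => (hsmall ε hε).imp fun J hJ =>
      Eventually.of_forall fun _ j hj => hJ _ (hj.trans (Nat.le_succ j)))
  obtain ⟨J, hJ⟩ := hsmall (1 / 2) (by norm_num)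
  obtain ⟨K, hK⟩ := exists_nat_ge (cSeq θ D 1 + 1)
  set i := max J K with hi
  have hiK : cSeq θ D 1 + 1 ≤ i := hK.trans (by exact_mod_cast le_max_right J K)
  -- The shifted sequence is affine with parameter `θ + i - c 1`. Subtracting `1/2` puts `1/2 + D`
  -- in `[0, 1]`, and `i ≥ c 1 + 1` keeps `t` positive.
  set t := θ + i - cSeq θ D 1 - 1 / 2 with ht
  have htpos : 0 < t := by rw [ht]; linarith
  have hc : (fun l => cSeq θ D (i + l) - cSeq θ D 1)
      = cSeq (θ + i - cSeq θ D 1) (fun l => D (i + l)) := by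
    ext l
    simp only [cSeq]
    push_cast
    ring
  have hge : ∀ l, cSeq θ D 1 ≤ cSeq θ D (l + 1) := fun l => by
    induction l with
    | zero => exact le_rfl
    | succ l hl => exact hl.trans (h.mono (l + 1) (by omega))
  have hlow := ((tendsto_abelCoeff_ratio θ (tendsto_id (α := ℕ)) (tendsto_const_nhds (x := t))
    i).const_mul t).const_mul (divPow i (cSeq θ D 1))
  have hdp : 0 < divPow i (cSeq θ D 1) := by unfold divPow; positivity
  refine lt_of_lt_of_le (by positivity) (le_of_tendsto_of_tendsto hlow hlim ?_)
  filter_upwards [eventually_gt_atTop i] with n hn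
  simp only [id]
  rw [← mul_div_assoc, ← mul_div_assoc]
  refine div_le_div_of_nonneg_right ?_ (abelCoeff_pos n hθ.le).le
  have hs := divPow_mul_betaSeq_shift_le (cSeq θ D) h.nonneg h.mono i (n - i)
  rw [Nat.add_sub_cancel' hn.le, hc] at hs
  refine le_trans (mul_le_mul_of_nonneg_left ?_ hdp.le) hs
  refine le_betaSeq_cSeq ?_ (fun l hl => ?_) (fun l => ?_) (by omega)
  · rw [← hc]
    simpa using hge i
  · rw [← hc]
    simpa [add_assoc] using h.mono (i + l) (by omega)
  · have := abs_le.1 (hJ (i + (l + 1)) ((le_max_left J K).trans (Nat.le_add_right _ _)))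
    constructor <;> linarith [this.1, this.2]


/-! ### V_M as a partial sum of the limiting series -/

theorem hasDerivAt_divPow_succ (n : ℕ) (x : ℝ) :
    HasDerivAt (divPow (n + 1)) (divPow n x) x := by
  have h := (hasDerivAt_pow (n + 1) x).div_const ((n + 1).factorial : ℝ)
  refine h.congr_deriv ?_
  have : (n.factorial : ℝ) ≠ 0 := by positivity
  rw [divPow, Nat.factorial_succ]
  push_cast
  field_simp

theorem hasDerivAt_exp_neg_mul_sum_divPow (n : ℕ) (x : ℝ) :
    HasDerivAt (fun x => -(Real.exp (-x) * ∑ r ∈ range (n + 1), divPow r x))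
      (divPow n x * Real.exp (-x)) x := by
  have hexp : HasDerivAt (fun x : ℝ => Real.exp (-x)) (-Real.exp (-x)) x := by
    simpa using (hasDerivAt_neg x).exp
  induction n with
  | zero => simpa using hexp.fun_neg
  | succ n ih =>
    have h := ih.sub (hexp.mul (hasDerivAt_divPow_succ n x))
    refine (h.congr_deriv (by ring)).congr_of_eventuallyEq (Eventually.of_forall fun y => ?_)
    simp only [Pi.sub_apply, Pi.mul_apply]
    rw [Finset.sum_range_succ _ (n + 1)]
    ring

/-- The incomplete gamma function at an integer as a Poisson probability. -/
theorem lowerGamma_succ (n : ℕ) (x : ℝ) :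
    lowerGamma (n + 1) x
      = n.factorial * (1 - Real.exp (-x) * ∑ r ∈ range (n + 1), divPow r x) := by
  have h := intervalIntegral.integral_eq_sub_of_hasDerivAt (a := 0) (b := x)
    (fun y _ => (hasDerivAt_exp_neg_mul_sum_divPow n y).const_mul (n.factorial : ℝ))
    (Continuous.intervalIntegrable (by unfold divPow; fun_prop) _ _)
  have h0 : ∑ r ∈ range (n + 1), divPow r 0 = 1 := by
    rw [Finset.sum_range_succ', Finset.sum_eq_zero fun r _ => divPow_zero_right (by omega)]
    simp
  rw [h0] at h
  have hn : (n.factorial : ℝ) ≠ 0 := by positivity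
  calc lowerGamma (n + 1) x = ∫ y in (0 : ℝ)..x, n.factorial * (divPow n y * Real.exp (-y)) := by
        unfold lowerGamma divPow
        refine intervalIntegral.integral_congr fun y _ => ?_
        simp only [Nat.add_sub_cancel]
        field_simp
    _ = _ := by rw [h]; simp; ring

theorem sum_sub_mul_divPow (n : ℕ) (x : ℝ) :
    ∑ r ∈ range (n + 1), ((r : ℝ) - x) * divPow r x = -(x ^ (n + 1) / n.factorial) := by
  induction n with
  | zero => simp
  | succ n ih =>
    rw [Finset.sum_range_succ, ih, divPow, Nat.factorial_succ]
    have : (n.factorial : ℝ) ≠ 0 := by positivity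
    push_cast
    field_simp
    ring

/-- Writing the incomplete gammas as Poisson sums leaves `-exp (-x) * ∑ (θ + n - x) * divPow n x`
from the first two terms. Expanding `divPow n x` along β gives a double sum that cancels the Poisson
sums of the other terms, except for `j = m`; as `x = c (m + 1)`, that remainder is `limitTerm θ D
m`. -/
theorem VM_succ (θ : ℝ) (D : ℕ → ℝ) (m : ℕ) :
    VM θ D (m + 1)
      = 2 / √(2 * Real.pi) * (θ + ∑ j ∈ range (m + 1), limitTerm θ D j) := by
  set c := cSeq θ D with hc
  set x := c (m + 1) with hx
  have hfirst : θ / m.factorial * lowerGamma (m + 1) x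
      + x ^ (m + 1) / m.factorial * Real.exp (-x)
      = θ - Real.exp (-x) * ∑ n ∈ range (m + 1), (θ + n - x) * divPow n x := by
    have h := sum_sub_mul_divPow m x
    have h2 : ∑ n ∈ range (m + 1), (θ + n - x) * divPow n x
        = θ * ∑ n ∈ range (m + 1), divPow n x - x ^ (m + 1) / m.factorial := by
      rw [sub_eq_add_neg, ← h, Finset.mul_sum, ← Finset.sum_add_distrib]
      exact Finset.sum_congr rfl fun n _ => by ring
    have : (m.factorial : ℝ) ≠ 0 := by positivity
    rw [h2, lowerGamma_succ]
    field_simp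
    ring
  have hterm : ∀ j ∈ range m,
      betaSeq c j * Real.exp (-c (j + 1)) * (D (j + 1) / ((m - j).factorial : ℝ)) *
          lowerGamma (m - j + 1) (x - c (j + 1))
        - betaSeq c j * ((x - c (j + 1)) ^ (m - j + 1) / ((m - j).factorial : ℝ)) * Real.exp (-x)
      = limitTerm θ D j + Real.exp (-x) * ∑ r ∈ range (m + 1 - j),
          betaSeq c j * ((θ + (j + r : ℕ) - x) * divPow r (x - c (j + 1))) := by
    intro j hj
    have hj := Finset.mem_range.1 hj
    have h := sum_sub_mul_divPow (m - j) (x - c (j + 1))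
    have h2 : ∑ r ∈ range (m + 1 - j),
          betaSeq c j * ((θ + (j + r : ℕ) - x) * divPow r (x - c (j + 1)))
        = -betaSeq c j * (D (j + 1) * ∑ r ∈ range (m - j + 1), divPow r (x - c (j + 1))
          + (x - c (j + 1)) ^ (m - j + 1) / ((m - j).factorial : ℝ)) := by
      have hcj : c (j + 1) = θ + j + D (j + 1) := by rw [hc, cSeq]; push_cast; ring
      calc _ = ∑ r ∈ range (m - j + 1), (-(betaSeq c j * D (j + 1)) * divPow r (x - c (j + 1))
              + betaSeq c j * ((r - (x - c (j + 1))) * divPow r (x - c (j + 1)))) := by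
            rw [show m + 1 - j = m - j + 1 by omega]
            refine Finset.sum_congr rfl fun r _ => ?_
            rw [hcj]
            push_cast
            ring
        _ = _ := by
            rw [Finset.sum_add_distrib, ← Finset.mul_sum, ← Finset.mul_sum, h]
            ring
    have h3 : Real.exp (-c (j + 1)) * Real.exp (-(x - c (j + 1))) = Real.exp (-x) := by
      rw [← Real.exp_add]; congr 1; ring
    have : ((m - j).factorial : ℝ) ≠ 0 := by positivity
    rw [h2, lowerGamma_succ, limitTerm, ← h3]
    field_simp
    ring
  have hflip := Finset.sum_range_diag_flip (m + 1) (fun j r =>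
    betaSeq c j * ((θ + (j + r : ℕ) - x) * divPow r (x - c (j + 1))))
  have hflip' : ∑ n ∈ range (m + 1), (θ + n - x) * divPow n x
      = ∑ j ∈ range (m + 1), ∑ r ∈ range (m + 1 - j),
          betaSeq c j * ((θ + (j + r : ℕ) - x) * divPow r (x - c (j + 1))) := by
    rw [← hflip]
    refine Finset.sum_congr rfl fun n _ => ?_
    rw [← sum_range_betaSeq_mul_divPow c n x, Finset.mul_sum]
    refine Finset.sum_congr rfl fun j hj => ?_
    have hj := Finset.mem_range.1 hj
    rw [show j + (n - j) = n by omega]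
    ring
  have hlast : limitTerm θ D m = -(Real.exp (-x) * (betaSeq c m * (θ + m - x))) := by
    have : x = θ + m + D (m + 1) := by rw [hx, hc, cSeq]; push_cast; ring
    rw [limitTerm, ← hc, ← hx, this]
    ring
  have hIcc : ∀ f : ℕ → ℝ, ∑ j ∈ Finset.Icc 1 (m + 1 - 1), f j = ∑ j ∈ range m, f (j + 1) := by
    intro f
    rw [Finset.range_eq_Ico, Finset.sum_Ico_add' f 0 m 1]
    rfl
  -- Isolate the contribution `j = m`, for which only `r = 0` occurs.
  rw [Finset.sum_range_succ _ m, Finset.sum_range_succ (fun j => ∑ r ∈ range (m + 1 - j), _) m,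
    show m + 1 - m = 1 by omega, Finset.sum_range_one, ← Finset.sum_range_succ] at hflip'
  rw [VM, hIcc, hIcc, add_sub_assoc, ← Finset.sum_sub_distrib]
  simp only [Nat.add_sub_cancel, Nat.add_sub_add_right]
  rw [← hc, ← hx, hfirst, Finset.sum_congr rfl hterm, Finset.sum_add_distrib, ← Finset.mul_sum,
    hflip', Finset.sum_range_succ _ m, hlast]
  simp only [divPow_zero_left, add_zero]
  ring


/-! ### First-passage decomposition of the blackout probability -/

theorem orderStat_le_iff {N : ℕ} (x : Fin N → ℝ) (i : Fin N) (t : ℝ) :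
    orderStat x i ≤ t ↔ (i : ℕ) + 1 ≤ #{j | x j ≤ t} := by
  have h := Tuple.lt_card_le_iff_apply_le_of_monotone (f := orderStat x) (a := t) (j := i)
    (Tuple.monotone_sort x)
  rw [← h, Nat.succ_le_iff]
  have : #{j | orderStat x j ≤ t} = #{j | x j ≤ t} :=
    Finset.card_equiv (Tuple.sort x) fun j => by
      simp only [Finset.mem_filter, Finset.mem_univ, true_and]
      rfl
  rw [this]

theorem le_blackoutSize_iff {N k : ℕ} (hk : k ≤ N) (l : ℕ → ℝ) (x : Fin N → ℝ) :
    k ≤ blackoutSize l x ↔ ∀ i, 1 ≤ i → i ≤ k → i ≤ #{j | x j ≤ l i} := by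
  have hg := blackoutSize_isGreatest l x
  constructor
  · intro h i hi hik
    obtain ⟨i, rfl⟩ := Nat.exists_eq_add_of_le' hi
    exact (orderStat_le_iff x ⟨i, by omega⟩ _).1 (hg.1.2 ⟨i, by omega⟩ (hik.trans h))
  · intro h
    exact hg.2 ⟨hk, fun i hi => (orderStat_le_iff x i _).2 (h _ (by omega) hi)⟩

section FirstPassage

variable {Ω ι : Type*} {C : ι → Ω → ℝ} {F : ℝ → ℝ} {l : ℕ → ℝ}

/-- The event that, for every `1 ≤ i ≤ m`, at least `i` of the variables indexed by `J` lie below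
the level `l i`. -/
def coverEvent (C : ι → Ω → ℝ) (l : ℕ → ℝ) (J : Finset ι) (m : ℕ) : Set Ω :=
  {ω | ∀ i, 1 ≤ i → i ≤ m → i ≤ #{j ∈ J | C j ω ≤ l i}}

/-- The event that level `m + 1` is the first one with too few variables below it. -/
def failEvent (C : ι → Ω → ℝ) (l : ℕ → ℝ) (J : Finset ι) (m : ℕ) : Set Ω :=
  {ω | ω ∈ coverEvent C l J m ∧ #{j ∈ J | C j ω ≤ l (m + 1)} ≤ m}

theorem measurableSet_le_card {Ω ι : Type*} [MeasurableSpace Ω] (J : Finset ι) (f : ι → Ω → ℝ) (hf : ∀ j ∈ J, Measurable (f j))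
    (t : ℝ) (i : ℕ) : MeasurableSet {ω | i ≤ #{j ∈ J | f j ω ≤ t}} := by
  simp only [Finset.card_filter]
  refine measurableSet_le measurable_const (Finset.measurable_sum _ fun j hj => ?_)
  exact Measurable.ite (measurableSet_le (hf j hj) measurable_const) measurable_const
    measurable_const

/-- `K` is the set of variables below `l (m + 1)`. Failure gives at most `m` of them, and coverage
of level `m` with monotone levels gives at least `m`. -/
theorem failEvent_eq_biUnion [DecidableEq ι] (hl : Monotone l) (J : Finset ι) (m : ℕ) :
    failEvent C l J m = ⋃ K ∈ J.powersetCard m,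
      coverEvent C l K m ∩ {ω | ∀ j ∈ J \ K, C j ω ∈ Set.Ioi (l (m + 1))} := by
  ext ω
  simp only [Set.mem_iUnion, Finset.mem_powersetCard, exists_prop]
  constructor
  · rintro ⟨h1, h2⟩
    have hsub : ∀ i, i ≤ m + 1 → ({j ∈ {j ∈ J | C j ω ≤ l (m + 1)} | C j ω ≤ l i} : Finset ι)
        = {j ∈ J | C j ω ≤ l i} := fun i hi => by
      rw [Finset.filter_filter]
      refine Finset.filter_congr fun j _ => ⟨fun h => h.2, fun h => ⟨h.trans (hl hi), h⟩⟩
    refine ⟨{j ∈ J | C j ω ≤ l (m + 1)}, ⟨Finset.filter_subset _ _, le_antisymm h2 ?_⟩,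
      fun i hi him => ?_, fun j hj => ?_⟩
    · rcases Nat.eq_zero_or_pos m with h0 | h0
      · omega
      · refine (h1 m h0 le_rfl).trans (Finset.card_le_card fun j hj => ?_)
        rw [Finset.mem_filter] at hj ⊢
        exact ⟨hj.1, hj.2.trans (hl (Nat.le_succ m))⟩
    · rw [hsub i (by omega)]
      exact h1 i hi him
    · simp only [Finset.mem_sdiff, Finset.mem_filter, not_and, not_le] at hj
      exact hj.2 hj.1
  · rintro ⟨K, ⟨hK, hKm⟩, h1, h2⟩
    refine ⟨fun i hi him => (h1 i hi him).trans
      (Finset.card_le_card (Finset.filter_subset_filter _ hK)), ?_⟩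
    rw [← hKm]
    refine Finset.card_le_card fun j hj => ?_
    rw [Finset.mem_filter] at hj
    by_contra hjK
    have := h2 j (Finset.mem_sdiff.2 ⟨hj.1, hjK⟩)
    rw [← hKm] at this
    exact absurd hj.2 (not_le.2 this)

/-- The set `K` is recovered from the outcome, which makes the union in `failEvent_eq_biUnion`
disjoint. -/
theorem filter_eq_of_coverEvent [DecidableEq ι] (hl : Monotone l) {J K : Finset ι} {m : ℕ} (hK : K ⊆ J)
    (hKm : #K = m) {ω : Ω} (h1 : ω ∈ coverEvent C l K m)
    (h2 : ∀ j ∈ J \ K, C j ω ∈ Set.Ioi (l (m + 1))) : {j ∈ J | C j ω ≤ l (m + 1)} = K := by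
  have hall : ∀ j ∈ K, C j ω ≤ l (m + 1) := by
    rcases Nat.eq_zero_or_pos m with h0 | h0
    · rw [h0, Finset.card_eq_zero] at hKm
      simp [hKm]
    · have h3 := h1 m h0 le_rfl
      have h4 := Finset.eq_of_subset_of_card_le (Finset.filter_subset _ K) (hKm.trans_le h3)
      intro j hj
      rw [← h4, Finset.mem_filter] at hj
      exact hj.2.trans (hl (Nat.le_succ m))
  ext j
  rw [Finset.mem_filter]
  constructor
  · rintro ⟨hj, hjl⟩
    by_contra hjK
    exact absurd hjl (not_le.2 (h2 j (Finset.mem_sdiff.2 ⟨hj, hjK⟩)))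
  · exact fun hj => ⟨hK hj, hall j hj⟩

variable [MeasurableSpace Ω] {P : Measure Ω} [IsProbabilityMeasure P]

theorem measurableSet_coverEvent (hC : ∀ j, Measurable (C j)) (J : Finset ι) (m : ℕ) :
    MeasurableSet (coverEvent C l J m) := by
  have : coverEvent C l J m
      = ⋂ i, ⋂ (_ : 1 ≤ i), ⋂ (_ : i ≤ m), {ω | i ≤ #{j ∈ J | C j ω ≤ l i}} := by
    ext ω; simp [coverEvent]
  rw [this]
  exact MeasurableSet.iInter fun i => MeasurableSet.iInter fun _ => MeasurableSet.iInter fun _ =>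
    measurableSet_le_card J C (fun j _ => hC j) _ _

theorem measurableSet_failEvent (hC : ∀ j, Measurable (C j)) (J : Finset ι) (m : ℕ) :
    MeasurableSet (failEvent C l J m) := by
  have : failEvent C l J m
      = coverEvent C l J m ∩ {ω | m + 1 ≤ #{j ∈ J | C j ω ≤ l (m + 1)}}ᶜ := by
    ext ω; simp [failEvent]
  rw [this]
  exact (measurableSet_coverEvent hC J m).inter
    (measurableSet_le_card J C (fun j _ => hC j) _ _).compl

theorem measureReal_coverEvent_succ (hC : ∀ j, Measurable (C j)) (J : Finset ι) (m : ℕ) :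
    P.real (coverEvent C l J (m + 1))
      = P.real (coverEvent C l J m) - P.real (failEvent C l J m) := by
  have hu : coverEvent C l J m = coverEvent C l J (m + 1) ∪ failEvent C l J m := by
    ext ω
    constructor
    · intro h
      by_cases h1 : #{j ∈ J | C j ω ≤ l (m + 1)} ≤ m
      · exact Or.inr ⟨h, h1⟩
      · refine Or.inl fun i hi him => ?_
        rcases Nat.lt_or_ge m i with h2 | h2
        · obtain rfl : i = m + 1 := by omega
          omega
        · exact h i hi h2
    · rintro (h | h)
      · exact fun i hi him => h i hi (by omega)
      · exact h.1
  have hd : Disjoint (coverEvent C l J (m + 1)) (failEvent C l J m) := by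
    rw [Set.disjoint_left]
    intro ω h1 h2
    have := h1 (m + 1) (by omega) le_rfl
    have := h2.2
    omega
  rw [hu, measureReal_union hd (measurableSet_failEvent hC J m)]
  ring

/-- The two events depend on disjoint blocks of an independent family, and the second is itself an
intersection of independent events. -/
theorem measureReal_coverEvent_inter [DecidableEq ι] (hC : ∀ j, Measurable (C j)) (hind : iIndepFun C P)
    (hF : ∀ j x, P.real {ω | C j ω ≤ x} = F x) (K L : Finset ι) (hKL : Disjoint K L) (m : ℕ)
    (t : ℝ) :
    P.real (coverEvent C l K m ∩ {ω | ∀ j ∈ L, C j ω ∈ Set.Ioi t})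
      = P.real (coverEvent C l K m) * (1 - F t) ^ #L := by
  have hI := hind.indepFun_finset K L hKL hC
  have e1 : coverEvent C l K m = (fun ω (j : K) => C j ω) ⁻¹'
      coverEvent (fun (j : K) (y : K → ℝ) => y j) l Finset.univ m := by
    ext ω
    simp only [coverEvent, Set.mem_ofPred_eq, Set.mem_preimage]
    refine forall_congr' fun i => forall_congr' fun _ => forall_congr' fun _ => ?_
    rw [← Finset.card_map (Function.Embedding.subtype _)]
    have : ({j ∈ K | C j ω ≤ l i} : Finset ι)
        = Finset.map (Function.Embedding.subtype _) ({j : K | C j ω ≤ l i} : Finset K) := by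
      ext j
      simp [and_comm]
    rw [this]
  have e2 : {ω | ∀ j ∈ L, C j ω ∈ Set.Ioi t} = (fun ω (j : L) => C j ω) ⁻¹'
      Set.univ.pi fun _ => Set.Ioi t := by
    ext ω
    simp
  have e3 : {ω | ∀ j ∈ L, C j ω ∈ Set.Ioi t} = ⋂ j ∈ L, C j ⁻¹' Set.Ioi t := by
    ext ω
    simp
  have h1 : P.real {ω | ∀ j ∈ L, C j ω ∈ Set.Ioi t} = (1 - F t) ^ #L := by
    rw [e3, measureReal_def, hind.measure_inter_preimage_eq_mul L fun _ _ => measurableSet_Ioi,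
      ENNReal.toReal_prod, ← Finset.prod_const]
    refine Finset.prod_congr rfl fun j _ => ?_
    have : C j ⁻¹' Set.Ioi t = {ω | C j ω ≤ t}ᶜ := by ext ω; simp
    rw [this, ← measureReal_def, probReal_compl_eq_one_sub
      (measurableSet_le (hC j) measurable_const), hF]
  rw [← h1, e2, e1, measureReal_def, hI.measure_inter_preimage_eq_mul _ _
    (measurableSet_coverEvent (fun j => measurable_pi_apply j) _ _)
    (MeasurableSet.univ_pi fun _ => measurableSet_Ioi), ENNReal.toReal_mul]
  rfl

theorem measureReal_failEvent [DecidableEq ι] (hC : ∀ j, Measurable (C j)) (hind : iIndepFun C P)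
    (hF : ∀ j x, P.real {ω | C j ω ≤ x} = F x) (hl : Monotone l) (J : Finset ι) (m : ℕ) :
    P.real (failEvent C l J m) = ∑ K ∈ J.powersetCard m,
      P.real (coverEvent C l K m) * (1 - F (l (m + 1))) ^ (#J - m) := by
  rw [failEvent_eq_biUnion hl, measureReal_biUnion_finset]
  · refine Finset.sum_congr rfl fun K hK => ?_
    obtain ⟨h1, h2⟩ := Finset.mem_powersetCard.1 hK
    rw [measureReal_coverEvent_inter hC hind hF _ _ Finset.disjoint_sdiff,
      Finset.card_sdiff_of_subset h1, h2]
  · intro K hK K' hK' hne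
    obtain ⟨h1, h2⟩ := Finset.mem_powersetCard.1 hK
    obtain ⟨h1', h2'⟩ := Finset.mem_powersetCard.1 hK'
    refine Set.disjoint_left.2 fun ω h h' => hne ?_
    rw [← filter_eq_of_coverEvent hl h1 h2 h.1 h.2, ← filter_eq_of_coverEvent hl h1' h2' h'.1 h'.2]
  · intro K _
    refine (measurableSet_coverEvent hC K m).inter ?_
    have : {ω | ∀ j ∈ J \ K, C j ω ∈ Set.Ioi (l (m + 1))}
        = ⋂ j ∈ J \ K, C j ⁻¹' Set.Ioi (l (m + 1)) := by
      ext ω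
      simp
    rw [this]
    exact Finset.measurableSet_biInter _ fun j _ => hC j measurableSet_Ioi

/-- The probability that no level up to `k` fails. -/
theorem measureReal_coverEvent [DecidableEq ι] (hC : ∀ j, Measurable (C j)) (hind : iIndepFun C P)
    (hF : ∀ j x, P.real {ω | C j ω ≤ x} = F x) (hl : Monotone l) (J : Finset ι) (k : ℕ)
    (hk : k ≤ #J) :
    P.real (coverEvent C l J k) = 1 - (#J).factorial * ∑ m ∈ range k,
      betaSeq (fun i => F (l i)) m * divPow (#J - m) (1 - F (l (m + 1))) := by
  set p : ℕ → ℝ := fun i => F (l i) with hp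
  induction hn : #J using Nat.strong_induction_on generalizing J k with
  | _ n ih =>
    subst hn
    induction k with
    | zero =>
      have : coverEvent C l J 0 = Set.univ := by
        ext ω
        simp only [coverEvent, Set.mem_ofPred_eq, Set.mem_univ, iff_true]
        omega
      simp [this]
    | succ k ihk =>
      rw [measureReal_coverEvent_succ hC, ihk (by omega), Finset.sum_range_succ,
        measureReal_failEvent hC hind hF hl]
      have hK : ∀ K ∈ J.powersetCard k, P.real (coverEvent C l K k)
          * (1 - F (l (k + 1))) ^ (#J - k)
          = k.factorial * betaSeq p k * (1 - F (l (k + 1))) ^ (#J - k) := fun K hK => by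
        obtain ⟨_, h2⟩ := Finset.mem_powersetCard.1 hK
        have hk0 : (k.factorial : ℝ) ≠ 0 := by positivity
        -- The strong induction applies to the smaller set `K` with all its `k` levels; there the
        -- formula collapses to `k! * betaSeq p k` by the β identity at `x = 1`.
        rw [ih k (by omega) K k h2.ge h2, betaSeq_eq_sub p k 1, divPow, one_pow]
        simp only [hp]
        field_simp
      rw [Finset.sum_congr rfl hK, Finset.sum_const, Finset.card_powersetCard, nsmul_eq_mul,
        divPow]
      have h3 : ((#J).choose k : ℝ) * (k.factorial : ℝ) * ((#J - k).factorial : ℝ)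
          = ((#J).factorial : ℝ) := by
        exact_mod_cast Nat.choose_mul_factorial_mul_factorial (by omega : k ≤ #J)
      have h4 : ((#J - k).factorial : ℝ) ≠ 0 := by positivity
      rw [← h3]
      simp only [hp]
      field_simp
      ring

end FirstPassage

/-- The distribution of the blackout size in terms of `betaSeq`. -/
theorem IsSurplusSample.measureReal_le_blackoutSize {Ω : Type*} [MeasurableSpace Ω] {N : ℕ}
    {P : Measure Ω} [IsProbabilityMeasure P] {C : Fin N → Ω → ℝ} {F : ℝ → ℝ}
    (h : IsSurplusSample P C F) {l : ℕ → ℝ}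
    (hl : ∀ i, 1 ≤ i → i + 1 ≤ N → F (l i) ≤ F (l (i + 1))) {k : ℕ} (hk : k ≤ N) (p : ℕ → ℝ)
    (hp : ∀ i, 1 ≤ i → i ≤ k → p i = F (l i)) :
    P.real {ω | k ≤ blackoutSize l (fun j => C j ω)} = 1 - N.factorial * ∑ m ∈ range k,
      betaSeq p m * divPow (N - m) (1 - p (m + 1)) := by
  rcases Nat.eq_zero_or_pos N with rfl | hN
  · obtain rfl : k = 0 := by omega
    simp
  have hmeas : ∀ (j : Fin N) x, MeasurableSet {ω | C j ω ≤ x} := fun j x =>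
    measurableSet_le (h.measurable j) measurable_const
  -- Only `F ∘ l` is known to be monotone, not `l`. The running maximum of `l` has the same values
  -- of `F`, hence almost surely the same variables below each level.
  set L : ℕ → ℝ := fun i => partialSups (fun i => l (i + 1)) (i - 1) with hL
  have hLm : Monotone L := fun a b hab => (partialSups _).monotone (Nat.sub_le_sub_right hab 1)
  have hL1 : ∀ i, L (i + 1) = partialSups (fun i => l (i + 1)) i := fun i => rfl
  have hlL : ∀ i, l (i + 1) ≤ L (i + 1) := fun i => le_partialSups (fun i => l (i + 1)) i
  have hFL : ∀ i, i + 1 ≤ N → F (L (i + 1)) = F (l (i + 1)) := fun i => by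
    induction i with
    | zero => intro _; simp [hL1]
    | succ i ih =>
      intro hi
      have h1 := ih (by omega)
      have h2 := hl (i + 1) (by omega) hi
      have h3 : L (i + 1 + 1) = max (L (i + 1)) (l (i + 1 + 1)) := by
        rw [hL1, hL1, partialSups_add_one]
      have hmono : Monotone F := fun a b hab => by
        rw [← h.distribution ⟨0, hN⟩ a, ← h.distribution ⟨0, hN⟩ b]
        exact measureReal_mono fun ω hω => le_trans hω hab
      rw [h3, hmono.map_max, h1, max_eq_right h2]
  have hae : ∀ᵐ ω ∂P, ∀ (j : Fin N) (i : ℕ), i + 1 ≤ N →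
      (C j ω ≤ L (i + 1) ↔ C j ω ≤ l (i + 1)) := by
    rw [ae_all_iff]
    intro j
    rw [ae_all_iff]
    intro i
    by_cases hi : i + 1 ≤ N
    · have hsub : {ω | C j ω ≤ l (i + 1)} ⊆ {ω | C j ω ≤ L (i + 1)} :=
        fun ω hω => le_trans hω (hlL i)
      have h0 : P.real ({ω | C j ω ≤ L (i + 1)} \ {ω | C j ω ≤ l (i + 1)}) = 0 := by
        rw [measureReal_sdiff hsub (hmeas _ _), h.distribution, h.distribution, hFL i hi, sub_self]
      rw [measureReal_eq_zero_iff] at h0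
      filter_upwards [measure_eq_zero_iff_ae_notMem.1 h0] with ω hω _
      exact ⟨fun h1 => by_contra fun h2 => hω ⟨h1, h2⟩, fun h1 => hsub h1⟩
    · exact Eventually.of_forall fun ω h => absurd h hi
  have hset : {ω | k ≤ blackoutSize l (fun j => C j ω)} =ᵐ[P] coverEvent C L Finset.univ k := by
    filter_upwards [hae] with ω hω
    refine propext ((le_blackoutSize_iff hk l _).trans ?_)
    refine forall_congr' fun i => forall_congr' fun hi => forall_congr' fun hik => ?_
    obtain ⟨i, rfl⟩ := Nat.exists_eq_add_of_le' hi
    rw [Finset.filter_congr fun j _ => (hω j i (hik.trans hk)).symm]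
  rw [measureReal_congr hset, measureReal_coverEvent h.measurable h.indep h.distribution hLm _ _
    (by simpa using hk)]
  simp only [Finset.card_univ, Fintype.card_fin]
  congr 2
  refine Finset.sum_congr rfl fun m hm => ?_
  have hm := Finset.mem_range.1 hm
  have hpL : ∀ i, 1 ≤ i → i ≤ k → F (L i) = p i := fun i hi hik => by
    obtain ⟨i, rfl⟩ := Nat.exists_eq_add_of_le' hi
    rw [hp _ hi hik, hFL i (hik.trans hk)]
  rw [betaSeq_congr m fun i h1 h2 => hpL i h1 (by omega), hpL (m + 1) (by omega) hm]


/-! ### Averaging against the increments of √(1/m - 1/N) -/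

/-- The tail function `√(1 / m - 1 / N)`. -/
noncomputable def tailFn (N m : ℕ) : ℝ := √(1 / (m : ℝ) - 1 / (N : ℝ))

theorem one_div_sub_one_div {N m : ℕ} (hm : 1 ≤ m) (hmN : m ≤ N) :
    1 / (m : ℝ) - 1 / (N : ℝ) = ((N - m : ℕ) : ℝ) / (m * N) := by
  have h1 : (0 : ℝ) < m := by exact_mod_cast hm
  have h2 : (0 : ℝ) < N := by exact_mod_cast hm.trans hmN
  rw [Nat.cast_sub hmN]
  field_simp

theorem tailFn_self (N : ℕ) : tailFn N N = 0 := by simp [tailFn]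

theorem tailFn_pos {N m : ℕ} (hm : 1 ≤ m) (hmN : m < N) : 0 < tailFn N m := by
  have h1 : (0 : ℝ) < m := by exact_mod_cast hm
  have h2 : (0 : ℝ) < N := by exact_mod_cast (by omega : 0 < N)
  have h3 : (0 : ℝ) < (N - m : ℕ) := by exact_mod_cast Nat.sub_pos_of_lt hmN
  rw [tailFn, one_div_sub_one_div hm hmN.le]
  positivity

theorem tailFn_succ_le {N m : ℕ} (hm : 1 ≤ m) : tailFn N (m + 1) ≤ tailFn N m := by
  have h1 : (0 : ℝ) < m := by exact_mod_cast hm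
  unfold tailFn
  push_cast
  gcongr
  linarith

theorem div_le_tailFn {N m : ℕ} (hm : 1 ≤ m) (hmN : m ≤ N) :
    √((N - m : ℕ) : ℝ) / N ≤ tailFn N m := by
  have h1 : (0 : ℝ) < m := by exact_mod_cast hm
  have h2 : (m : ℝ) ≤ N := by exact_mod_cast hmN
  have h3 : (0 : ℝ) < N := h1.trans_le h2
  rw [tailFn, one_div_sub_one_div hm hmN, ← Real.sqrt_sq h3.le, ← Real.sqrt_div (by positivity),
    Real.sqrt_sq h3.le, sq]
  gcongr

theorem tailFn_sub_le {N K : ℕ} (hN : 1 ≤ N) (hK : 2 * K ≤ N) :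
    tailFn N (N - K) ≤ √(2 * K) / N := by
  have h1 : (0 : ℝ) < N := by exact_mod_cast hN
  have h2 : (2 : ℝ) * K ≤ N := by exact_mod_cast hK
  have h3 : ((N - K : ℕ) : ℝ) = N - K := Nat.cast_sub (by omega)
  have h4 : (0 : ℝ) < (N - K : ℕ) := by rw [h3]; linarith
  rw [tailFn, one_div_sub_one_div (by omega) (by omega), Nat.sub_sub_self (by omega),
    ← Real.sqrt_sq h1.le, ← Real.sqrt_div (by positivity), Real.sqrt_sq h1.le]
  refine Real.sqrt_le_sqrt ?_
  rw [div_le_div_iff₀ (by positivity) (by positivity), h3]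
  have hK0 : (0 : ℝ) ≤ K := by positivity
  have : (0 : ℝ) ≤ K * N * (N - 2 * K) :=
    mul_nonneg (mul_nonneg hK0 h1.le) (by linarith)
  nlinarith

theorem sum_Ico_tailFn_sub {N a : ℕ} (ha : a ≤ N) :
    ∑ m ∈ Finset.Ico a N, (tailFn N m - tailFn N (m + 1)) = tailFn N a := by
  rw [Finset.sum_Ico_eq_sum_range]
  have h := Finset.sum_range_sub' (fun i => tailFn N (a + i)) (N - a)
  rw [Nat.add_sub_cancel' ha, tailFn_self, sub_zero] at h
  exact h

/-- Weighted averages with respect to the increments of `tailFn` converge when the averaged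
quantities do away from the endpoint `m = N`. -/
theorem tendsto_weighted_average {k : ℕ → ℕ} (hk : Tendsto k atTop atTop)
    (hNk : Tendsto (fun N => N - k N) atTop atTop) {a : ℕ → ℕ → ℝ}
    {L C : ℝ} (hC : ∀ᶠ N in atTop, ∀ m, k N ≤ m → m < N → |a N m| ≤ C)
    (hL : ∀ ε > 0, ∃ K, ∀ᶠ N in atTop, ∀ m, k N ≤ m → m + K ≤ N → |a N m - L| ≤ ε) :
    Tendsto (fun N => (∑ m ∈ Finset.Ico (k N) N,
      a N m * (tailFn N m - tailFn N (m + 1))) / tailFn N (k N)) atTop (𝓝 L) := by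
  rw [Metric.tendsto_nhds]
  intro ε hε
  obtain ⟨K, hK⟩ := hL (ε / 2) (by positivity)
  have hNk' : Tendsto (fun N => √((N - k N : ℕ) : ℝ)) atTop atTop :=
    Real.tendsto_sqrt_atTop.comp (tendsto_natCast_atTop_atTop.comp hNk)
  have hz : Tendsto (fun N => (|C| + |L|) * (√(2 * K) / √((N - k N : ℕ) : ℝ))) atTop (𝓝 0) := by
    simpa using (tendsto_const_nhds.div_atTop hNk').const_mul (|C| + |L|)
  filter_upwards [hC, hK, hk.eventually_ge_atTop 1, hNk.eventually_ge_atTop (K + 1),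
    hz.eventually (gt_mem_nhds (by positivity : 0 < ε / 2)), eventually_ge_atTop (2 * K)]
    with N h1 h2 h3 h4 h5 h6
  have hkN' : k N < N := by omega
  have hg := tailFn_pos h3 hkN'
  have hN : (0 : ℝ) < N := by exact_mod_cast h3.trans hkN'.le
  have hinc : ∀ m, k N ≤ m → 0 ≤ tailFn N m - tailFn N (m + 1) := fun m hm =>
    sub_nonneg.2 (tailFn_succ_le (h3.trans hm))
  have hb1 : ∑ m ∈ Finset.Ico (k N) (N - K),
      |a N m - L| * (tailFn N m - tailFn N (m + 1)) ≤ ε / 2 * tailFn N (k N) := by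
    calc _ ≤ ∑ m ∈ Finset.Ico (k N) (N - K), ε / 2 * (tailFn N m - tailFn N (m + 1)) := by
          refine Finset.sum_le_sum fun m hm => ?_
          have hm := Finset.mem_Ico.1 hm
          exact mul_le_mul_of_nonneg_right (h2 m hm.1 (by omega)) (hinc m hm.1)
      _ ≤ ∑ m ∈ Finset.Ico (k N) N, ε / 2 * (tailFn N m - tailFn N (m + 1)) := by
          refine Finset.sum_le_sum_of_subset_of_nonneg
            (Finset.Ico_subset_Ico le_rfl (Nat.sub_le _ _)) fun m hm _ => ?_
          exact mul_nonneg (by positivity) (hinc m (Finset.mem_Ico.1 hm).1)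
      _ = _ := by rw [← Finset.mul_sum, sum_Ico_tailFn_sub hkN'.le]
  have hb2 : ∑ m ∈ Finset.Ico (N - K) N,
      |a N m - L| * (tailFn N m - tailFn N (m + 1)) ≤ (|C| + |L|) * tailFn N (N - K) := by
    calc _ ≤ ∑ m ∈ Finset.Ico (N - K) N, (|C| + |L|) * (tailFn N m - tailFn N (m + 1)) := by
          refine Finset.sum_le_sum fun m hm => ?_
          have hm := Finset.mem_Ico.1 hm
          refine mul_le_mul_of_nonneg_right ?_ (hinc m (by omega))
          exact (abs_sub _ _).trans (add_le_add_left ((h1 m (by omega) hm.2).trans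
            (le_abs_self C)) _)
      _ = _ := by rw [← Finset.mul_sum, sum_Ico_tailFn_sub (Nat.sub_le _ _)]
  -- The last `K` levels, where `a` is only bounded, carry a vanishing share of the total weight
  -- because `N - k N → ∞`.
  have hb3 : tailFn N (N - K) ≤ √(2 * K) / √((N - k N : ℕ) : ℝ) * tailFn N (k N) := by
    have hs : 0 < √((N - k N : ℕ) : ℝ) := by
      have : (0 : ℝ) < (N - k N : ℕ) := by exact_mod_cast Nat.sub_pos_of_lt hkN'
      positivity
    calc tailFn N (N - K) ≤ √(2 * K) / N := tailFn_sub_le (by omega) h6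
      _ = √(2 * K) / √((N - k N : ℕ) : ℝ) * (√((N - k N : ℕ) : ℝ) / N) := by field_simp
      _ ≤ _ := by gcongr; exact div_le_tailFn h3 hkN'.le
  have hsplit : ∑ m ∈ Finset.Ico (k N) N, |a N m - L| * (tailFn N m - tailFn N (m + 1))
      < ε * tailFn N (k N) := by
    rw [← Finset.sum_Ico_consecutive _ (by omega : k N ≤ N - K) (Nat.sub_le _ _)]
    have : (|C| + |L|) * tailFn N (N - K) < ε / 2 * tailFn N (k N) := by
      calc _ ≤ (|C| + |L|) * (√(2 * K) / √((N - k N : ℕ) : ℝ) * tailFn N (k N)) := by gcongr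
        _ = (|C| + |L|) * (√(2 * K) / √((N - k N : ℕ) : ℝ)) * tailFn N (k N) := by ring
        _ < _ := by gcongr
    linarith
  rw [Real.dist_eq, div_sub' hg.ne', abs_div, abs_of_pos hg, div_lt_iff₀ hg]
  refine lt_of_le_of_lt ?_ hsplit
  rw [← sum_Ico_tailFn_sub hkN'.le, Finset.sum_mul, ← Finset.sum_sub_distrib]
  refine (Finset.abs_sum_le_sum_abs _ _).trans (Finset.sum_le_sum fun m hm => ?_)
  have h := hinc m (Finset.mem_Ico.1 hm).1
  rw [mul_comm _ L, ← sub_mul, abs_mul, abs_of_nonneg h]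

/-! ### Asymptotics of the affine masses -/

/-- The mass at `m` of the blackout size distribution for `N = m + r` in the affine case, up to
the factor `θ`. -/
noncomputable def affineMass (θ : ℝ) (m r : ℕ) : ℝ :=
  ((m + r).factorial : ℝ) / ((m + r : ℕ) : ℝ) ^ (m + r) * abelCoeff m θ * divPow r (r - θ)

/-- For `r ≥ 1`, `divPow r (r - θ)` is `(r - θ) * abelCoeff r (-θ)`, so the Abel asymptotics apply.
-/
theorem tendsto_divPow_sub (θ : ℝ) :
    Tendsto (fun r : ℕ => divPow r (r - θ) * Real.exp (-r) * √r) atTop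
      (𝓝 (Real.exp (-θ) / √(2 * Real.pi))) := by
  have h2 : Tendsto (fun r : ℕ => 1 - θ / (r : ℝ)) atTop (𝓝 1) := by
    simpa using (tendsto_const_div_atTop_nhds_zero_nat θ).const_sub 1
  have h := (tendsto_abelCoeff tendsto_id (tendsto_const_nhds (x := -θ))).mul h2
  rw [mul_one] at h
  refine h.congr' ?_
  filter_upwards [eventually_ge_atTop 1] with r hr
  have hr' : (r : ℝ) ≠ 0 := by positivity
  obtain ⟨s, rfl⟩ := Nat.exists_eq_add_of_le' hr
  simp only [abelCoeff, divPow, id, Nat.add_sub_cancel, ← sub_eq_add_neg, pow_succ]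
  field_simp

/-- A difference of square roots is the difference of squares, `1 / (m * (m + 1))`, over the sum.
The left side is the Stirling order of the affine mass; the two correction factors tend to `1` and
`2`. -/
theorem sqrt_div_eq_increment {m r : ℕ} (hm : 1 ≤ m) (hr : 1 ≤ r) :
    √((m + r : ℕ) : ℝ) / (m * √m * √r)
      = (1 + 1 / (m : ℝ)) * (1 + √((1 - 1 / (r : ℝ)) * (1 + 1 / (m : ℝ))⁻¹)) *
        (tailFn (m + r) m - tailFn (m + r) (m + 1)) := by
  have h1 : (0 : ℝ) < m := by exact_mod_cast hm
  have h2 : (1 : ℝ) ≤ r := by exact_mod_cast hr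
  have h3 : (0 : ℝ) < ((m + r : ℕ) : ℝ) := by exact_mod_cast (by omega : 0 < m + r)
  have hg := tailFn_pos hm (by omega : m < m + r)
  have hgm : tailFn (m + r) m = √r / (√m * √((m + r : ℕ) : ℝ)) := by
    rw [tailFn, one_div_sub_one_div hm (by omega), Nat.add_sub_cancel_left,
      Real.sqrt_div (by positivity), Real.sqrt_mul h1.le]
  have hratio : √((1 - 1 / (r : ℝ)) * (1 + 1 / (m : ℝ))⁻¹) * tailFn (m + r) m
      = tailFn (m + r) (m + 1) := by
    have : 0 ≤ 1 - 1 / (r : ℝ) := by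
      rw [sub_nonneg, div_le_one (by positivity)]; exact h2
    rw [tailFn, tailFn, ← Real.sqrt_mul (by positivity)]
    congr 1
    push_cast
    field_simp
    ring
  have hsq : tailFn (m + r) m ^ 2 - tailFn (m + r) (m + 1) ^ 2 = 1 / (m * ((m : ℝ) + 1)) := by
    rw [tailFn, tailFn, Real.sq_sqrt, Real.sq_sqrt]
    · push_cast
      field_simp
      ring
    · rw [one_div_sub_one_div (by omega) (by omega)]; positivity
    · rw [one_div_sub_one_div (by omega) (by omega)]; positivity
  have hprod : (1 + √((1 - 1 / (r : ℝ)) * (1 + 1 / (m : ℝ))⁻¹)) *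
      (tailFn (m + r) m - tailFn (m + r) (m + 1)) * tailFn (m + r) m
      = 1 / (m * ((m : ℝ) + 1)) := by
    rw [← hsq, ← hratio]
    ring
  rw [mul_assoc (1 + 1 / (m : ℝ)), ← mul_right_cancel_iff_of_pos hg,
    mul_assoc (1 + 1 / (m : ℝ)), hprod, hgm]
  have e1 : √(m : ℝ) ^ 2 = m := Real.sq_sqrt h1.le
  have e2 : √(m : ℝ) ≠ 0 := by positivity
  have e3 : √(r : ℝ) ≠ 0 := by positivity
  have e4 : √((m + r : ℕ) : ℝ) ≠ 0 := by positivity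
  field_simp
  rw [e1]

theorem affineMass_eq (θ : ℝ) {m r : ℕ} (hm : 1 ≤ m) (hr : 1 ≤ r) :
    affineMass θ m r
      = ((m + r).factorial : ℝ) * Real.exp (m + r : ℕ) /
          (((m + r : ℕ) : ℝ) ^ (m + r) * √((m + r : ℕ) : ℝ)) *
        (abelCoeff m θ * Real.exp (-m) * (m * √m)) * (divPow r (r - θ) * Real.exp (-r) * √r) *
        (1 + 1 / (m : ℝ)) * (1 + √((1 - 1 / (r : ℝ)) * (1 + 1 / (m : ℝ))⁻¹)) *
        (tailFn (m + r) m - tailFn (m + r) (m + 1)) := by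
  have h1 : (0 : ℝ) < m := by exact_mod_cast hm
  have h2 : (0 : ℝ) < r := by exact_mod_cast hr
  have h3 : (0 : ℝ) < ((m + r : ℕ) : ℝ) := by exact_mod_cast (by omega : 0 < m + r)
  rw [mul_assoc (_ * (1 + 1 / (m : ℝ))), mul_assoc (_ * _ : ℝ) (1 + 1 / (m : ℝ)),
    ← mul_assoc (1 + 1 / (m : ℝ)), ← sqrt_div_eq_increment hm hr, affineMass, Real.exp_neg,
    Real.exp_neg]
  have e2 : √(m : ℝ) ≠ 0 := by positivity
  have e3 : √(r : ℝ) ≠ 0 := by positivity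
  have e4 : √((m + r : ℕ) : ℝ) ≠ 0 := by positivity
  have e5 : Real.exp ((m + r : ℕ) : ℝ) = Real.exp m * Real.exp r := by
    rw [← Real.exp_add]; push_cast; rfl
  rw [e5]
  have e6 : Real.exp (m : ℝ) ≠ 0 := by positivity
  have e7 : Real.exp (r : ℝ) ≠ 0 := by positivity
  have e8 : ((m + r : ℕ) : ℝ) ^ (m + r) ≠ 0 := by positivity
  field_simp

/-- The ratio of `affineMass` and the increment of `tailFn`. -/
theorem exists_affineMass_ratio (θ : ℝ) : ∃ τ : ℕ → ℕ → ℝ, ∃ C : ℝ,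
    (∀ m r, 1 ≤ m → 1 ≤ r → affineMass θ m r
      = τ m r * (tailFn (m + r) m - tailFn (m + r) (m + 1))) ∧
    (∀ m r, 1 ≤ m → 1 ≤ r → |τ m r| ≤ C) ∧
    Tendsto (fun x : ℕ × ℕ => τ x.1 x.2) (atTop ×ˢ atTop) (𝓝 (2 / √(2 * Real.pi))) := by
  have hadd : Tendsto (fun x : ℕ × ℕ => x.1 + x.2) (atTop ×ˢ atTop) atTop :=
    tendsto_atTop_mono (fun x => Nat.le_add_right x.1 x.2) tendsto_fst
  have l1 := tendsto_factorial_div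
  have l2 := tendsto_abelCoeff tendsto_id (tendsto_const_nhds (x := θ))
  have l3 := tendsto_divPow_sub θ
  simp only [id] at l2
  obtain ⟨C₁, hC₁⟩ := l1.abs.bddAbove_range
  obtain ⟨C₂, hC₂⟩ := l2.abs.bddAbove_range
  obtain ⟨C₃, hC₃⟩ := l3.abs.bddAbove_range
  have l4 : Tendsto (fun x : ℕ × ℕ => 1 + 1 / (x.1 : ℝ)) (atTop ×ˢ atTop) (𝓝 1) := by
    simpa using ((tendsto_const_div_atTop_nhds_zero_nat (1 : ℝ)).comp
      (tendsto_fst (f := (atTop : Filter ℕ)) (g := (atTop : Filter ℕ)))).const_add 1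
  have l5 : Tendsto (fun x : ℕ × ℕ => 1 - 1 / (x.2 : ℝ)) (atTop ×ˢ atTop) (𝓝 1) := by
    simpa using ((tendsto_const_div_atTop_nhds_zero_nat (1 : ℝ)).comp
      (tendsto_snd (f := (atTop : Filter ℕ)) (g := (atTop : Filter ℕ)))).const_sub 1
  -- `τ` is read off from `affineMass_eq` by unification; each of its last two factors is at most
  -- `2`.
  refine ⟨fun m r => _, C₁ * C₂ * C₃ * 2 * 2, fun m r hm hr => affineMass_eq θ hm hr,
    fun m r hm hr => ?_, ?_⟩
  · have h1 : (1 : ℝ) ≤ m := by exact_mod_cast hm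
    have h2 : (1 : ℝ) ≤ r := by exact_mod_cast hr
    have b1 := hC₁ ⟨m + r, rfl⟩
    have b2 := hC₂ ⟨m, rfl⟩
    have b3 := hC₃ ⟨r, rfl⟩
    have hm1 : 1 / (m : ℝ) ≤ 1 := by rw [div_le_one (by positivity)]; exact h1
    have hm0 : 0 < 1 / (m : ℝ) := by positivity
    have hr0 : 0 < 1 / (r : ℝ) := by positivity
    have b4 : |1 + 1 / (m : ℝ)| ≤ 2 := by rw [abs_of_pos (by positivity)]; linarith
    have b5 : |1 + √((1 - 1 / (r : ℝ)) * (1 + 1 / (m : ℝ))⁻¹)| ≤ 2 := by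
      rw [abs_of_pos (by positivity)]
      have : √((1 - 1 / (r : ℝ)) * (1 + 1 / (m : ℝ))⁻¹) ≤ 1 := by
        refine Real.sqrt_le_one.2 ?_
        rw [← div_eq_mul_inv, div_le_one (by positivity)]
        linarith
      linarith
    have hC₁0 := (abs_nonneg _).trans b1
    have hC₂0 := (abs_nonneg _).trans b2
    have hC₃0 := (abs_nonneg _).trans b3
    rw [abs_mul, abs_mul, abs_mul, abs_mul]
    exact mul_le_mul (mul_le_mul (mul_le_mul (mul_le_mul b1 b2 (abs_nonneg _) hC₁0) b3
      (abs_nonneg _) (by positivity)) b4 (abs_nonneg _) (by positivity)) b5 (abs_nonneg _)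
      (by positivity)
  · have h := ((((l1.comp hadd).mul (l2.comp tendsto_fst)).mul (l3.comp tendsto_snd)).mul l4).mul
      (((l5.mul (l4.inv₀ one_ne_zero)).sqrt).const_add 1)
    have e : √(2 * Real.pi) * (Real.exp θ / √(2 * Real.pi)) * (Real.exp (-θ) / √(2 * Real.pi)) * 1
        * (1 + √(1 * 1⁻¹)) = 2 / √(2 * Real.pi) := by
      have : √(2 * Real.pi) ≠ 0 := by positivity
      rw [Real.exp_neg]
      simp only [inv_one, mul_one, Real.sqrt_one]
      field_simp
      norm_num
    rw [e] at h
    exact h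


/-! ### Uniformity in the index and truncation at `k N` -/

/-- Sequential smallness along `i N ≤ k N` is uniform smallness. -/
theorem CondD.uniform {Δ : ℕ → ℕ → ℝ} {k : ℕ → ℕ} (hD : CondD Δ k)
    (hk : Tendsto k atTop atTop) {ε : ℝ} (hε : 0 < ε) :
    ∃ J, ∀ᶠ N in atTop, ∀ i, J ≤ i → i ≤ k N → |Δ i N| ≤ ε := by
  by_contra hcon
  push Not at hcon
  obtain ⟨φ, hφ, hP⟩ := extraction_forall_of_frequently hcon
  choose j hj1 hj2 hj3 using hP
  classical
  -- The violating indices along `φ` are completed by `k N`, which also tends to infinity, to a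
  -- sequence to which condition (D) applies.
  set i : ℕ → ℕ := fun N => if h : ∃ n, N = φ n then j h.choose else k N with hi
  have hiφ : ∀ n, i (φ n) = j n := fun n => by
    have h : ∃ m, φ n = φ m := ⟨n, rfl⟩
    simp only [hi, dif_pos h]
    rw [hφ.injective h.choose_spec.symm]
  have hik : ∀ N, i N ≤ k N := fun N => by
    by_cases h : ∃ n, N = φ n
    · obtain ⟨n, rfl⟩ := h
      rw [hiφ]
      exact hj2 n
    · simp only [hi, dif_neg h, le_refl]
  have hit : Tendsto i atTop atTop := by
    refine tendsto_atTop.2 fun b => ?_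
    filter_upwards [hk.eventually_ge_atTop b, eventually_ge_atTop (φ b)] with N h1 h2
    by_cases h : ∃ n, N = φ n
    · obtain ⟨n, rfl⟩ := h
      rw [hiφ]
      exact (hφ.le_iff_le.1 h2).trans (hj1 n)
    · simpa only [hi, dif_neg h] using h1
  have h1 := ((hD i hik hit).comp hφ.tendsto_atTop).eventually (Metric.ball_mem_nhds 0 hε)
  obtain ⟨n, hn⟩ := h1.exists
  rw [Function.comp, hiφ, Real.dist_0_eq_abs] at hn
  exact absurd hn (not_lt.2 (hj3 n).le)

/-- The perturbations, replaced by `0` beyond the index `k N`. -/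
noncomputable def truncation (Δ : ℕ → ℕ → ℝ) (k : ℕ → ℕ) (N i : ℕ) : ℝ :=
  if i ≤ k N then Δ i N else 0

section Truncation

variable {θ : ℝ} {Δ : ℕ → ℕ → ℝ} {k : ℕ → ℕ} {D : ℕ → ℝ}

theorem tendsto_truncation (hk : Tendsto k atTop atTop) (hC : CondC Δ D) (j : ℕ) :
    Tendsto (fun N => truncation Δ k N (j + 1)) atTop (𝓝 (D (j + 1))) := by
  refine (hC.1 (j + 1) (by omega)).congr' ?_
  filter_upwards [hk.eventually_ge_atTop (j + 1)] with N hN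
  rw [truncation, if_pos hN]

theorem truncation_uniform (hk : Tendsto k atTop atTop) (hD : CondD Δ k) (ε : ℝ) (hε : 0 < ε) :
    ∃ J, ∀ᶠ N in atTop, ∀ j, J ≤ j → |truncation Δ k N (j + 1)| ≤ ε := by
  obtain ⟨J, hJ⟩ := hD.uniform hk hε
  refine ⟨J, hJ.mono fun N hN j hj => ?_⟩
  rw [truncation]
  split_ifs with h
  · exact hN _ (by omega) h
  · simpa using hε.le

theorem exists_admissible_truncation (hk : Tendsto k atTop atTop) (hkN : ∀ N, k N ≤ N)
    (hA : CondA θ Δ) (hB : CondB Δ) (hC : CondC Δ D) (hD : CondD Δ k) :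
    ∃ B : ℝ, 0 ≤ B ∧ ∀ᶠ N in atTop, Admissible θ B (truncation Δ k N) := by
  -- The threshold `1` is what keeps the sequence monotone across the cut: from `k N` to `k N + 1`
  -- the affine part gains `1` while the perturbation drops to `0`.
  obtain ⟨J, hJ⟩ := truncation_uniform hk hD 1 one_pos
  refine ⟨1 + ∑ j ∈ range J, |D (j + 1)|, by positivity, ?_⟩
  have hhead : ∀ᶠ N in atTop, ∀ j ∈ range J,
      |truncation Δ k N (j + 1)| ≤ |D (j + 1)| + 1 := by
    rw [Filter.eventually_all_finset]
    intro j _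
    exact ((tendsto_truncation hk hC j).abs.eventually
      (gt_mem_nhds (lt_add_one _))).mono fun N h => h.le
  filter_upwards [hJ, hhead, hk.eventually_ge_atTop (J + 1)] with N h1 h2 h3
  have hN := hkN N
  refine ⟨?_, fun i hi => ?_, fun j => ?_⟩
  · have := (hA N 1 le_rfl (by omega)).1
    rw [cSeq, truncation, if_pos (by omega)]
    push_cast at this ⊢
    linarith
  · simp only [cSeq]
    push_cast
    rcases Nat.lt_or_ge i (k N) with h | h
    · have := hB N i hi (by omega)
      rw [truncation, truncation, if_pos h.le, if_pos (by omega)]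
      linarith
    · have h4 : truncation Δ k N (i + 1) = 0 := by rw [truncation, if_neg (by omega)]
      have h5 := h1 (i - 1) (by omega)
      rw [Nat.sub_add_cancel hi] at h5
      rw [h4]
      linarith [(abs_le.1 h5).2]
  · rcases Nat.lt_or_ge j J with h | h
    · refine (h2 j (Finset.mem_range.2 h)).trans ?_
      have := Finset.single_le_sum (f := fun j => |D (j + 1)|) (fun j _ => abs_nonneg _)
        (Finset.mem_range.2 h)
      linarith
    · exact (h1 j h).trans (le_add_of_nonneg_right (Finset.sum_nonneg fun j _ => abs_nonneg _))

/-- Choosing a violating `m N ≥ k N` whenever one exists reduces uniformity to convergence along a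
single sequence. -/
theorem truncation_ratio_uniform (hθ : 0 < θ) (hk : Tendsto k atTop atTop)
    (hkN : ∀ N, k N ≤ N) (hA : CondA θ Δ) (hB : CondB Δ) (hC : CondC Δ D) (hD : CondD Δ k)
    {ε : ℝ} (hε : 0 < ε) :
    ∀ᶠ N in atTop, ∀ m, k N ≤ m →
      |betaSeq (cSeq θ (truncation Δ k N)) m / abelCoeff m θ - ratioLimit θ D| ≤ ε := by
  obtain ⟨B, hB0, hadm⟩ := exists_admissible_truncation hk hkN hA hB hC hD
  by_contra hcon
  classical
  set p : ℕ → ℕ → Prop := fun N m => k N ≤ m ∧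
    ε < |betaSeq (cSeq θ (truncation Δ k N)) m / abelCoeff m θ - ratioLimit θ D| with hp
  set m : ℕ → ℕ := fun N => if h : ∃ m, p N m then h.choose else k N with hm
  have hmk : ∀ N, k N ≤ m N := fun N => by
    by_cases h : ∃ m, p N m
    · simp only [hm, dif_pos h]
      exact h.choose_spec.1
    · simp only [hm, dif_neg h, le_refl]
  have hlim := tendsto_betaSeq_div_abelCoeff hθ hB0 (tendsto_atTop_mono hmk hk) hadm
    (tendsto_truncation hk hC) (truncation_uniform hk hD)
  refine hcon ?_
  filter_upwards [hlim.eventually (Metric.ball_mem_nhds _ hε)] with N hN j hj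
  by_contra hlt
  have h : ∃ m, p N m := ⟨j, hj, not_le.1 hlt⟩
  have h2 := h.choose_spec.2
  rw [Real.dist_eq] at hN
  simp only [hm, dif_pos h] at hN
  exact lt_asymm hN h2

theorem measureReal_le_blackoutSize_eq_sum {Ω : Type*} [MeasurableSpace Ω] {N : ℕ}
    {P : Measure Ω} [IsProbabilityMeasure P] {C : Fin N → Ω → ℝ} {F : ℝ → ℝ}
    (h : IsSurplusSample P C F) {l : ℕ → ℝ}
    (hF : ∀ i : ℕ, 1 ≤ i → i ≤ N → F (l i) = (θ + (i : ℝ) - 1 + Δ i N) / (N : ℝ))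
    (hB : CondB Δ) (hθ : 0 < θ) (hk : 1 ≤ k N) (hkN : k N ≤ N) :
    P.real {ω | k N ≤ blackoutSize l (fun j => C j ω)} = ∑ m ∈ Finset.Ico (k N) (N + 1),
      betaSeq (cSeq θ (truncation Δ k N)) m / abelCoeff m θ * affineMass θ m (N - m) := by
  have hN : (0 : ℝ) < N := by exact_mod_cast hk.trans hkN
  set c := cSeq θ (truncation Δ k N) with hc
  set p : ℕ → ℝ := fun i => (N : ℝ)⁻¹ * c i with hp
  have hmono : ∀ i, 1 ≤ i → i + 1 ≤ N → F (l i) ≤ F (l (i + 1)) := fun i hi hiN => by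
    have := hB N i hi hiN
    rw [hF i hi (by omega), hF (i + 1) (by omega) hiN]
    gcongr ?_ / _
    push_cast
    linarith
  have hpF : ∀ i, 1 ≤ i → i ≤ k N → p i = F (l i) := fun i hi hik => by
    rw [hF i hi (hik.trans hkN), hp]
    simp only [hc, cSeq, truncation, if_pos hik]
    rw [div_eq_inv_mul]
  rw [h.measureReal_le_blackoutSize hmono hkN p hpF]
  -- This identity is purely algebraic, so it holds although the truncated `p` need not stay in `[0,
  -- 1]` beyond `k N`. It exchanges the sum over `m < k N` for the one over `m ≥ k N`.
  have htot := sum_range_betaSeq_mul_divPow p N 1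
  have h1 : divPow N 1 = ((N.factorial : ℝ))⁻¹ := by simp [divPow]
  rw [h1, Finset.range_eq_Ico, ← Finset.sum_Ico_consecutive _ (Nat.zero_le (k N))
    (hkN.trans (Nat.le_succ N)), ← Finset.range_eq_Ico, ← eq_sub_iff_add_eq'] at htot
  have hfac : (N.factorial : ℝ) ≠ 0 := by positivity
  calc _ = (N.factorial : ℝ) * ((N.factorial : ℝ)⁻¹ - ∑ m ∈ range (k N),
        betaSeq p m * divPow (N - m) (1 - p (m + 1))) := by
        rw [mul_sub, mul_inv_cancel₀ hfac]
    _ = _ := by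
        rw [← htot, Finset.mul_sum]
        refine Finset.sum_congr rfl fun m hm => ?_
        obtain ⟨hkm, hmN⟩ := Finset.mem_Ico.1 hm
        have hmN' : m ≤ N := by omega
        obtain ⟨r, rfl⟩ := Nat.exists_eq_add_of_le hmN'
        have hab := (abelCoeff_pos m hθ.le).ne'
        have e1 : 1 - p (m + 1) = ((m + r : ℕ) : ℝ)⁻¹ * (r - θ) := by
          simp only [hp, hc, cSeq, truncation, if_neg (by omega : ¬ m + 1 ≤ k (m + r))]
          push_cast at hN ⊢
          field_simp
          ring
        have e2 : divPow r (((m + r : ℕ) : ℝ)⁻¹ * (r - θ))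
            = (((m + r : ℕ) : ℝ)⁻¹) ^ r * divPow r (r - θ) := by
          rw [divPow, divPow, mul_pow, mul_div_assoc]
        rw [Nat.add_sub_cancel_left, e1, e2, hp, betaSeq_smul, affineMass, pow_add, inv_pow,
          inv_pow]
        field_simp

end Truncation

/-! ### The endpoint term, the limit of V_M and the conclusion -/

theorem tendsto_sqrt_mul_affineMass_zero (θ : ℝ) {k : ℕ → ℕ} (hk : Tendsto k atTop atTop)
    (hNk : Tendsto (fun N => N - k N) atTop atTop) :
    Tendsto (fun N => affineMass θ N 0 / tailFn N (k N)) atTop (𝓝 0) := by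
  have hNk' : Tendsto (fun N => √((N - k N : ℕ) : ℝ)) atTop atTop :=
    Real.tendsto_sqrt_atTop.comp (tendsto_natCast_atTop_atTop.comp hNk)
  have h1 := (((tendsto_factorial_div.mul (tendsto_abelCoeff tendsto_id
    (tendsto_const_nhds (x := θ)))).abs).div_atTop hNk')
  refine squeeze_zero_norm' ?_ h1
  filter_upwards [hk.eventually_ge_atTop 1, hNk.eventually_ge_atTop 1] with N h2 h3
  have hN : (0 : ℝ) < N := by exact_mod_cast (by omega : 0 < N)
  have hr : (0 : ℝ) < (N - k N : ℕ) := by exact_mod_cast h3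
  have hs : 0 < √((N - k N : ℕ) : ℝ) := by positivity
  have he : affineMass θ N 0 = (N.factorial : ℝ) * Real.exp N / ((N : ℝ) ^ N * √N)
      * (abelCoeff N θ * Real.exp (-N) * (N * √N)) / N := by
    have : √(N : ℝ) ≠ 0 := by positivity
    rw [affineMass, Real.exp_neg]
    simp only [add_zero, divPow_zero_left, mul_one]
    field_simp
  rw [Real.norm_eq_abs, abs_div, he, abs_div, abs_of_pos hN,
    abs_of_pos (tailFn_pos h2 (by omega)), div_div]
  simp only [id]
  refine div_le_div_of_nonneg_left (abs_nonneg _) hs ?_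
  have := div_le_tailFn h2 (by omega : k N ≤ N)
  rw [div_le_iff₀ hN] at this
  linarith

theorem tendsto_VM {θ B : ℝ} {D : ℕ → ℝ} (hθ : 0 < θ) (hB : 0 ≤ B) (h : Admissible θ B D) :
    Tendsto (fun M => VM θ D M) atTop (𝓝 (2 / √(2 * Real.pi) * ratioLimit θ D)) := by
  rw [← tendsto_add_atTop_iff_nat 1]
  simp_rw [VM_succ]
  have hs := (h.summable_limitTerm hθ hB).hasSum.tendsto_sum_nat
  exact (((hs.comp (tendsto_add_atTop_nat 1)).const_add θ).const_mul _)

end Cascade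

theorem theorem3
    (Ω : ℕ → Type*) [∀ N, MeasurableSpace (Ω N)]
    (P : ∀ N, Measure (Ω N)) [∀ N, IsProbabilityMeasure (P N)]
    (F : ℝ → ℝ) (C : ∀ N, Fin N → Ω N → ℝ)
    (hC : ∀ N, Cascade.IsSurplusSample (P N) (C N) F)
    (l : ℕ → ℕ → ℝ) (θ : ℝ) (hθ : 0 < θ) (Δ : ℕ → ℕ → ℝ)
    (hF : ∀ N i : ℕ, 1 ≤ i → i ≤ N → F (l N i) = (θ + (i : ℝ) - 1 + Δ i N) / (N : ℝ))
    (k : ℕ → ℕ) (hkN : ∀ N, k N ≤ N) (hk : Tendsto k atTop atTop)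
    (hNk : Tendsto (fun N => N - k N) atTop atTop)
    (D : ℕ → ℝ)
    (hA : Cascade.CondA θ Δ) (hB : Cascade.CondB Δ)
    (hCC : Cascade.CondC Δ D) (hD : Cascade.CondD Δ k)
    (hpos : 0 < θ + D 1) :
    ∃ V : ℝ, 0 < V ∧ Tendsto (fun M => Cascade.VM θ D M) atTop (𝓝 V) ∧
      Tendsto (fun N : ℕ => √((k N : ℝ) * (N : ℝ) / ((N : ℝ) - (k N : ℝ))) *
        (P N).real {ω | k N ≤ Cascade.blackoutSize (l N) (fun j => C N j ω)})
        atTop (𝓝 V) := by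
  open Cascade in
  obtain ⟨B, hB0, hadm⟩ := exists_admissible_truncation hk hkN hA hB hCC hD
  have hadmD : Admissible θ B D := Admissible.of_tendsto hadm (tendsto_truncation hk hCC)
  have hVpos : 0 < ratioLimit θ D := ratioLimit_pos hθ hB0 hadmD (by simpa [cSeq] using hpos) hCC.2
  refine ⟨2 / √(2 * Real.pi) * ratioLimit θ D, by positivity, tendsto_VM hθ hB0 hadmD, ?_⟩
  obtain ⟨τ, K, hτ, hτK, hτlim⟩ := exists_affineMass_ratio θ
  set R : ℕ → ℕ → ℝ := fun N m => betaSeq (cSeq θ (truncation Δ k N)) m / abelCoeff m θ with hR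
  have hRlim : ∀ ε > 0, ∀ᶠ N in atTop, ∀ m, k N ≤ m → |R N m - ratioLimit θ D| ≤ ε :=
    fun ε hε => truncation_ratio_uniform hθ hk hkN hA hB hCC hD hε
  have hRb : ∀ᶠ N in atTop, ∀ m, k N ≤ m → |R N m| ≤ ratioLimit θ D + 1 :=
    (hRlim 1 one_pos).mono fun N hN m hm => by
      have := abs_le.1 (hN m hm)
      exact abs_le.2 ⟨by linarith [this.1], by linarith [this.2]⟩
  have hK0 : 0 ≤ K := (abs_nonneg _).trans (hτK 1 1 le_rfl le_rfl)
  have hmain := tendsto_weighted_average hk hNk (a := fun N m => R N m * τ m (N - m))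
    (L := 2 / √(2 * Real.pi) * ratioLimit θ D) (C := (ratioLimit θ D + 1) * K) (by
      filter_upwards [hRb, hk.eventually_ge_atTop 1] with N h1 h2 m hm hmN
      rw [abs_mul]
      exact mul_le_mul (h1 m hm) (hτK m (N - m) (by omega) (by omega)) (abs_nonneg _)
        (by positivity)) (by
      intro ε hε
      obtain ⟨J, hJ⟩ : ∃ J, ∀ m r, J ≤ m → J ≤ r →
          |τ m r - 2 / √(2 * Real.pi)| ≤ ε / (2 * ratioLimit θ D) := by
        have h := hτlim.eventually (Metric.ball_mem_nhds _
          (by positivity : 0 < ε / (2 * ratioLimit θ D)))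
        rw [prod_atTop_atTop_eq, eventually_atTop] at h
        obtain ⟨⟨a, b⟩, hab⟩ := h
        refine ⟨max a b, fun m r hm hr => ?_⟩
        have := hab (m, r) ⟨(le_max_left a b).trans hm, (le_max_right a b).trans hr⟩
        rw [Real.dist_eq] at this
        exact this.le
      refine ⟨J + 1, ?_⟩
      filter_upwards [hRlim (ε / (2 * (K + 1))) (by positivity),
        hk.eventually_ge_atTop (J + 1)] with N h1 h2 m hm hmN
      have e : R N m * τ m (N - m) - 2 / √(2 * Real.pi) * ratioLimit θ D
          = (R N m - ratioLimit θ D) * τ m (N - m)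
            + ratioLimit θ D * (τ m (N - m) - 2 / √(2 * Real.pi)) := by ring
      rw [e]
      refine (abs_add_le _ _).trans ?_
      rw [abs_mul, abs_mul, abs_of_pos hVpos]
      calc _ ≤ ε / (2 * (K + 1)) * (K + 1) + ratioLimit θ D * (ε / (2 * ratioLimit θ D)) := by
            gcongr
            · exact h1 m hm
            · exact (hτK m (N - m) (by omega) (by omega)).trans (by linarith)
            · exact hJ m (N - m) (by omega) (by omega)
        _ = ε := by field_simp; ring)
  -- The term `m = N` is treated apart, since the comparison with increments requires `r = N - m ≥
  -- 1`.
  have hlast : Tendsto (fun N => R N N * (affineMass θ N 0 / tailFn N (k N))) atTop (𝓝 0) := by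
    refine squeeze_zero_norm' ?_ (((tendsto_sqrt_mul_affineMass_zero θ hk hNk).norm).const_mul
      (ratioLimit θ D + 1) |>.trans (by simp))
    filter_upwards [hRb] with N h
    rw [norm_mul]
    gcongr
    exact h N (hkN N)
  have hsum := hmain.add hlast
  rw [add_zero] at hsum
  refine hsum.congr' ?_
  filter_upwards [hk.eventually_ge_atTop 1, hNk.eventually_ge_atTop 1] with N h1 h2
  have hkN' : k N < N := by omega
  rw [measureReal_le_blackoutSize_eq_sum (hC N) (hF N) hB hθ h1 (hkN N),
    Finset.sum_Ico_succ_top (hkN N), Nat.sub_self]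
  have hQ : √((k N : ℝ) * (N : ℝ) / ((N : ℝ) - (k N : ℝ))) = (tailFn N (k N))⁻¹ := by
    rw [tailFn, one_div_sub_one_div h1 (hkN N), ← Real.sqrt_inv, inv_div, Nat.cast_sub (hkN N)]
  rw [hQ, div_eq_inv_mul, div_eq_inv_mul, mul_left_comm (R N N), mul_add]
  congr 2
  · refine Finset.sum_congr rfl fun m hm => ?_
    obtain ⟨hm1, hm2⟩ := Finset.mem_Ico.1 hm
    have h := hτ m (N - m) (by omega) (by omega)
    rw [Nat.add_sub_cancel' hm2.le] at h
    rw [h]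
    simp only [hR]
    ring
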